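/- Let $\mathbb S$ be a Polish space with its Borel $\sigma$-algebra, let $b\neq 0$ and $\Sigma_v>0$ be real, let $s:\mathbb S\to\mathbb R$ be bounded and continuous, and put $$\rho_0=\operatorname{erf}\Big(\tfrac{2b}{\sqrt{2\Sigma_v}}\Big)+\frac{\sqrt{2\Sigma_v}}{2b}\,\frac{e^{-(2b/\sqrt{2\Sigma_v})^2}}{\sqrt\pi}-\frac1{2b}\frac{\sqrt{2\Sigma_v}}{\sqrt\pi},\qquad g^{y}(x)=\frac{\rho_0}{2}+\rho_0\,s(x)\,(\delta_{y,1}-\delta_{y,0}),\quad y\in\{0,1\}.$$ (1) $|\rho_0|\le 1$, and for each $y\in\{0,1\}$ the function $g^y$ is bounded and continuous. Assume moreover that $|s|\le\frac12$ (so that $\frac12\pm s(x)$ are probabilities). Let $\pi_0$ be a probability measure on $\mathbb S$, let $(K_t)_{t\ge0}$ be Feller Markov kernels on $\mathbb S$, and let $(Y_t)$ be random variables with values in $\{0,1\}$ on a probability space $(\Omega,\mathbb P)$ (possibly constant, i.e. a fixed record). Define recursively, along the record $Y$, for $t\ge 1$, $$p_t=K_{t-1}\pi_{t-1},\qquad \pi_t(A)=\frac{\int_A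 g^{Y_t}\,dp_t}{p_t g^{Y_t}},\qquad p_tg^{Y_t}=\int g^{Y_t}\,dp_t .$$ (2) Suppose that $X$ is a Markov chain with initial law $\pi_0$ and kernels $K_t$ (also conditionally on the past outcomes), and that, for $t\ge 1$, given $X_0,\dots,X_t,Y_1,\dots,Y_{t-1}$ the outcome $Y_t$ equals $y$ with probability $g^y(X_t)/(g^0(X_t)+g^1(X_t))$. Then for all $t\ge 1$ almost surely $p_tg^{Y_t}\ne0$, and for all $t\ge0$ the measure $\pi_t$ is the Bayesian posterior, i.e. a version of the conditional law of $X_t$ given $Y_1,\dots,Y_t$. (3) For each $n\ge1$, run on $(\Omega,\mathbb P)$ the bootstrap particle filter with $n$ particles, driven by $Y$ (the joint behaviour for different $n$ is arbitrary): $x_0^{(1)},\dots,x_0^{(n)}$ are i.i.d. with law $\pi_0$; for $t\ge1$, given all particles up to time $t-1$ and $Y_1,\dots,Y_{t-1}$, the $\bar x_t^{(i)}$ are independent, drawn from $K_{t-1}\pi^n_{t-1}$ where $\pi^n_t=\frac1n\sum_i\delta_{x_t^{(i)}}$ (or, alternatively, with $\bar x_t^{(i)}$ drawn from $K_{t-1}(x_{t-1}^{(i)},\cdot)$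 for every $i$); with weights $G_t^{(i)}=g^{Y_t}(\bar x_t^{(i)})/\sum_jg^{Y_t}(\bar x_t^{(j)})$ (read as $1/n$ if this denominator is $0$), given in addition the $\bar x_t^{(i)}$ and $Y_t$, the offspring numbers $(\xi_t^{(i)})_i$ are multinomial with $n$ trials and cell probabilities $G_t^{(i)}$; finally each $\bar x_t^{(i)}$ is replaced with $\xi_t^{(i)}$ copies, and the copies are relabelled, in any way, as $x_t^{(1)},\dots,x_t^{(n)}$. Put $p_t^n=\frac1n\sum_i\delta_{\bar x_t^{(i)}}$ and $\bar\pi_t^n=\sum_iG_t^{(i)}\delta_{\bar x_t^{(i)}}$. Then for all $t\ge1$, $n\ge1$ and all bounded measurable $f:\mathbb S\to\mathbb R$, $$\mathbb E\big[(p_t^nf-\pi_{t-1}^n(K_{t-1}f))^2\big]\le\frac{\|f\|_\infty^2}{n},\qquad \mathbb E\big[(\pi_t^nf-\bar\pi_t^nf)^2\big]\le\frac{\|f\|_\infty^2}{n}.$$ If $p_tg^{Y_t}\neq0$ almost surely for every $t\ge1$, then moreover, for $t\ge0$ respectively $t\ge1$, as $n\to\infty$, $$\pi^n_t\to\pi_t,\qquad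 p_t^n\to p_t,\qquad K_{t-1}\pi^n_{t-1}\to p_t,$$ each both in expectation ($\mathbb E|\mu^nf-\mu f|\to0$ for every bounded measurable $f$, in particular for every $f\in C_b(\mathbb S)$) and almost surely (almost surely, $\mu^n\to\mu$ weakly). -/

import Mathlib

open MeasureTheory ProbabilityTheory Filter Topology
open scoped ENNReal BoundedContinuousFunction

noncomputable section

namespace BornFilter

/-! ### The amplitude-quantized Born-rule likelihood -/

/-- The error function `erf z = (2 / √π) ∫₀ᶻ exp (-u²) du`. -/
def erf (z : ℝ) : ℝ := 2 / √Real.pi * ∫ u in (0 : ℝ)..z, Real.exp (-u ^ 2)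

/-- The scalar `ρ₀`, for the quantization bound `b` and the variance `V = Σ_v` of the Gaussian. -/
def rho0 (b V : ℝ) : ℝ :=
  erf (2 * b / √(2 * V))
    + √(2 * V) / (2 * b) * (Real.exp (-(2 * b / √(2 * V)) ^ 2) / √Real.pi)
    - 1 / (2 * b) * (√(2 * V) / √Real.pi)

/-- The likelihood `g^y(x) = ρ₀ / 2 + ρ₀ s(x) (δ_{y,1} - δ_{y,0})` of the outcome `y ∈ {0, 1}`. -/
def likelihood {S : Type*} (b V : ℝ) (s : S → ℝ) (y : Fin 2) (x : S) : ℝ :=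
  rho0 b V / 2 + rho0 b V * s x * ((if y = 1 then 1 else 0) - (if y = 0 then 1 else 0))

/-! ### The Bayesian posterior -/

section Posterior

variable {S : Type*} [MeasurableSpace S]

/-- The projective product `g * p`, i.e. `A ↦ (∫_A g dp) / (p g)`. -/
def bayesUpdate (g : S → ℝ) (p : Measure S) : Measure S :=
  p.withDensity fun x => ENNReal.ofReal (g x / ∫ z, g z ∂p)

/-- `π_t` for the record `y`: `π_0` is the prior and `π_{t+1} = g^{y_{t+1}} * (K_t π_t)`. -/
def posterior (prior : Measure S) (K : ℕ → Kernel S S) (g : Fin 2 → S → ℝ) (y : ℕ → Fin 2) :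
    ℕ → Measure S
  | 0 => prior
  | t + 1 => bayesUpdate (g (y (t + 1))) ((posterior prior K g y t).bind (K t))

/-- The predictive measure `p_{t+1} = K_t π_t` for the record `y`. -/
def predictive (prior : Measure S) (K : ℕ → Kernel S S) (g : Fin 2 → S → ℝ) (y : ℕ → Fin 2)
    (t : ℕ) : Measure S :=
  (posterior prior K g y t).bind (K t)

end Posterior

/-- The Feller property: a kernel maps bounded continuous functions to continuous functions
(boundedness of the image is automatic for a Markov kernel). -/
def IsFeller {S : Type*} [TopologicalSpace S] [MeasurableSpace S] (κ : Kernel S S) : Prop :=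
  ∀ f : S →ᵇ ℝ, Continuous fun x => ∫ z, f z ∂(κ x)

/-! ### Conditional laws and the state-space model -/

section Model

variable {Ω S : Type*} [mΩ : MeasurableSpace Ω] [MeasurableSpace S]

/-- The σ-algebra generated by `Z_s`, `s ∈ I`. -/
abbrev sigmaGen {E : Type*} [MeasurableSpace E] (I : Finset ℕ) (Z : ℕ → Ω → E) :
    MeasurableSpace Ω :=
  ⨆ s ∈ I, MeasurableSpace.comap (Z s) inferInstance

/-- The random measure `ν` is the conditional law of `Z` given the σ-algebra `m`:
`P(Z ∈ A | m) = ν(A)` almost surely, for every measurable `A`. -/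
def HasCondLaw {E : Type*} [MeasurableSpace E] (P : Measure Ω) (m : MeasurableSpace Ω)
    (Z : Ω → E) (ν : Ω → Measure E) : Prop :=
  ∀ A : Set E, MeasurableSet A → P⟦Z ⁻¹' A | m⟧ =ᵐ[P] fun ω => (ν ω).real A

/-- The state-space model: `X` is a Markov chain with initial law `prior` and transition kernels
`K t`, and given the past and `X_{t+1}`, the outcome `Y_{t+1}` has probabilities proportional to the
likelihood `g^y(X_{t+1})`, `y ∈ {0, 1}`. -/
structure IsStateSpaceModel (P : Measure Ω) (prior : Measure S) (K : ℕ → Kernel S S)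
    (g : Fin 2 → S → ℝ) (X : ℕ → Ω → S) (Y : ℕ → Ω → Fin 2) : Prop where
  measurable_X : ∀ t, Measurable (X t)
  measurable_Y : ∀ t, Measurable (Y t)
  init : P.map (X 0) = prior
  transition : ∀ t,
    HasCondLaw P (sigmaGen (Finset.range (t + 1)) X ⊔ sigmaGen (Finset.Icc 1 t) Y)
      (X (t + 1)) (fun ω => K t (X t ω))
  observation : ∀ t (y : Fin 2),
    P⟦Y (t + 1) ⁻¹' {y} | sigmaGen (Finset.range (t + 2)) X ⊔ sigmaGen (Finset.Icc 1 t) Y⟧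
      =ᵐ[P] fun ω => g y (X (t + 1) ω) / ∑ y' : Fin 2, g y' (X (t + 1) ω)

end Model

/-! ### The bootstrap particle filter with multinomial resampling -/

section ParticleFilter

variable {S : Type*} [MeasurableSpace S] {n : ℕ}

/-- The empirical measure `(1 / n) ∑ᵢ δ_{xᵢ}`. -/
def empirical (x : Fin n → S) : Measure S := (n : ℝ≥0∞)⁻¹ • ∑ i, Measure.dirac (x i)

/-- The weighted empirical measure `∑ᵢ Gᵢ δ_{xᵢ}`. -/
def weightedEmpirical (G : Fin n → ℝ) (x : Fin n → S) : Measure S :=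
  ∑ i, ENNReal.ofReal (G i) • Measure.dirac (x i)

/-- The normalized weights `Gᵢ = g(xᵢ) / ∑ⱼ g(xⱼ)`; if all the `g(xⱼ)` add up to zero, so that this
quotient is not defined, the weights are `1 / n`. -/
def weights (g : S → ℝ) (x : Fin n → S) (i : Fin n) : ℝ :=
  if ∑ j, g (x j) = 0 then 1 / n else g (x i) / ∑ j, g (x j)

/-- The multinomial distribution with `n` trials and cell probabilities `Gⱼ`: the law of
`j ↦ #{i | aᵢ = j}` for independent `a₁, …, aₙ` with `P(aᵢ = j) = Gⱼ`. -/
def multinomialLaw (G : Fin n → ℝ) : Measure (Fin n → ℕ) :=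
  (Measure.pi fun _ : Fin n => ∑ j, ENNReal.ofReal (G j) • Measure.dirac j).map
    fun (a : Fin n → Fin n) j => (Finset.univ.filter fun i => a i = j).card

/-- The two usual ways to move the particles: each new particle is drawn from the mixture
`κ ((1 / n) ∑ⱼ δ_{xⱼ})`, or the `i`-th new particle is drawn from `κ(xᵢ, ·)`. -/
inductive Mutation
  | mixture
  | individual

/-- The law of the `i`-th moved particle, given the current particles `x`. -/
def Mutation.law (κ : Kernel S S) (x : Fin n → S) (i : Fin n) : Mutation → Measure S
  | .mixture => (empirical x).bind κ
  | .individual => κ (x i)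

/-- The bootstrap filter with `n` particles and multinomial resampling, run with the (random) record
`Y`. Here `xbar (t + 1)` are the particles after the move from time `t`, `ξ (t + 1)` are the
offspring numbers, and `x (t + 1)` are the resampled particles, with an arbitrary labelling. -/
structure IsBootstrapFilter {Ω : Type*} [MeasurableSpace Ω] (P : Measure Ω) (prior : Measure S)
    (K : ℕ → Kernel S S) (g : Fin 2 → S → ℝ) (Y : ℕ → Ω → Fin 2) (mutation : Mutation)
    (x xbar : ℕ → Ω → Fin n → S) (ξ : ℕ → Ω → Fin n → ℕ) : Prop where
  measurable_x : ∀ t, Measurable (x t)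
  measurable_xbar : ∀ t, Measurable (xbar t)
  measurable_ξ : ∀ t, Measurable (ξ t)
  init : P.map (x 0) = Measure.pi fun _ => prior
  move : ∀ t,
    HasCondLaw P
      (sigmaGen (Finset.range (t + 1)) x ⊔ sigmaGen (Finset.Icc 1 t) xbar
        ⊔ sigmaGen (Finset.Icc 1 t) Y)
      (xbar (t + 1)) (fun ω => Measure.pi fun i => mutation.law (K t) (x t ω) i)
  offspring : ∀ t,
    HasCondLaw P
      (sigmaGen (Finset.range (t + 1)) x ⊔ sigmaGen (Finset.Icc 1 (t + 1)) xbar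
        ⊔ sigmaGen (Finset.Icc 1 (t + 1)) Y)
      (ξ (t + 1))
      (fun ω => multinomialLaw (weights (g (Y (t + 1) ω)) (xbar (t + 1) ω)))
  relabel : ∀ t, ∀ᵐ ω ∂P, ∃ a : Fin n → Fin n,
    (∀ i, x (t + 1) ω i = xbar (t + 1) ω (a i)) ∧
    ∀ j, ξ (t + 1) ω j = (Finset.univ.filter fun i => a i = j).card

end ParticleFilter

/-! ### Modes of convergence of random measures -/

section Convergence

variable {Ω S : Type*} [MeasurableSpace Ω] [MeasurableSpace S]

/-- `E |μⁿ f - ν f| → 0` for every bounded measurable `f` (in particular for `f` in `C_b`). -/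
def ConvergesInExpectation (P : Measure Ω) (μ : ℕ → Ω → Measure S) (ν : Ω → Measure S) : Prop :=
  ∀ f : S → ℝ, Measurable f → (∃ C, ∀ x, |f x| ≤ C) →
    (∀ n, 1 ≤ n → Integrable (fun ω => |∫ x, f x ∂(μ n ω) - ∫ x, f x ∂(ν ω)|) P) ∧
    Tendsto (fun n => ∫ ω, |∫ x, f x ∂(μ n ω) - ∫ x, f x ∂(ν ω)| ∂P) atTop (𝓝 0)

/-- Almost surely, `μⁿ → ν` weakly. -/
def ConvergesAlmostSurely [TopologicalSpace S] (P : Measure Ω) (μ : ℕ → Ω → Measure S)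
    (ν : Ω → Measure S) : Prop :=
  ∀ᵐ ω ∂P, ∀ f : S →ᵇ ℝ,
    Tendsto (fun n => ∫ x, f x ∂(μ n ω)) atTop (𝓝 (∫ x, f x ∂(ν ω)))

end Convergence

end BornFilter

end

namespace BornFilter

/-! ### Averages of independent bounded random variables -/

section Averages

variable {E : Type*} [MeasurableSpace E] {n : ℕ}

/-! With `a = 2b / √(2V)`, integration by parts gives `ρ₀ = (2/√π) ∫₀ᵃ (1 - u/a) exp(-u²) du`
(`rho0_eq_integral`), which is positive for `b > 0` and odd in `b`; hence `ρ₀ ≠ 0`. A nonzero factor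
of either sign cancels from the Bayes update, the weights and the outcome probabilities. The
likelihood may therefore be replaced by `1/2 ± s`, which is nonnegative and sums to one over the two
outcomes. The bound `|ρ₀| ≤ 1` follows from `erf ≤ 1`, since for `b > 0` the other two terms of `ρ₀`
have a nonpositive sum.

Posterior: there are finitely many records up to time `t`, so conditioning on the outcomes means
conditioning on the events that a given record occurs. Bayes' rule, by induction on `t`, gives
`P(record, X_t ∈ B) = P(record) π_t(B)` (`measureReal_inter_posterior`). The same computation shows
that a record with a vanishing normalizing constant has probability zero.

Particle filter: given the past, the moved particles are independent, and multinomial offspring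
numbers count independent draws. Either step thus adds the error of an average of `n` independent
variables bounded by `C`: its variance is at most `C²/n`, and Hoeffding bounds its tail by `2
exp(-nε²/(2C²))`. These tails are summable in `n`, so by Borel–Cantelli the errors vanish almost
surely, whatever the coupling between different `n`. Induction on `t` then gives `μⁿ f → μ f` almost
surely for each bounded measurable `f` (`ConvergesPointwise`): the kernel maps such functions to
such functions, and reweighting is a quotient of two integrals with nonzero limiting denominator.
Dominated convergence yields convergence in expectation; a countable family of test sets and the
portmanteau theorem yield almost sure weak convergence. -/

theorem integral_sq_average_sub_le (ρ : Fin n → Measure E) [∀ i, IsProbabilityMeasure (ρ i)]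
    {F : E → ℝ} (hF : Measurable F) {C : ℝ} (hC : ∀ z, |F z| ≤ C) :
    Integrable (fun z => ((∑ i, F (z i)) / n - (∑ i, ∫ a, F a ∂(ρ i)) / n) ^ 2) (Measure.pi ρ) ∧
    ∫ z, ((∑ i, F (z i)) / n - (∑ i, ∫ a, F a ∂(ρ i)) / n) ^ 2 ∂(Measure.pi ρ) ≤ C ^ 2 / n := by
  have hmem : ∀ i, MemLp F 2 (ρ i) := fun i =>
    MemLp.of_bound hF.aestronglyMeasurable C (ae_of_all _ hC)
  have hint : ∀ i, Integrable F (ρ i) := fun i => (hmem i).integrable one_le_two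
  have hmean : ∫ z, (∑ i, fun z : Fin n → E => F (z i)) z ∂(Measure.pi ρ)
      = ∑ i, ∫ a, F a ∂(ρ i) := by
    simp only [Finset.sum_apply]
    rw [integral_finsetSum _ fun i _ => (integrable_comp_eval (hint i))]
    exact Finset.sum_congr rfl fun i _ => integral_comp_eval (hint i).aestronglyMeasurable
  have hvar : ∀ i, variance F (ρ i) ≤ C ^ 2 := fun i => by
    refine (variance_le_expectation_sq hF.aestronglyMeasurable).trans ?_
    calc ∫ a, (F ^ 2) a ∂(ρ i) ≤ ∫ _, C ^ 2 ∂(ρ i) := by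
          refine integral_mono (hmem i).integrable_sq (integrable_const _) fun a => ?_
          exact sq_le_sq' (abs_le.1 (hC a)).1 (abs_le.1 (hC a)).2
      _ = C ^ 2 := by simp
  have h1 : ∫ z, ((∑ i, F (z i)) - ∑ i, ∫ a, F a ∂(ρ i)) ^ 2 ∂(Measure.pi ρ) ≤ n * C ^ 2 := by
    have := variance_sum_pi (X := fun _ : Fin n => F) hmem
    rw [variance_eq_integral (by fun_prop), hmean] at this
    simp only [Finset.sum_apply] at this
    rw [this]
    calc ∑ i, variance F (ρ i) ≤ ∑ _i : Fin n, C ^ 2 := Finset.sum_le_sum fun i _ => hvar i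
      _ = n * C ^ 2 := by simp
  have hsum : MemLp (fun z : Fin n → E => (∑ i, F (z i)) / n - (∑ i, ∫ a, F a ∂(ρ i)) / n) 2
      (Measure.pi ρ) := by
    simp_rw [div_eq_mul_inv]
    exact ((memLp_finsetSum _ fun i _ => (hmem i).comp_measurePreserving
      (measurePreserving_eval ρ i)).mul_const _).sub (memLp_const _)
  refine ⟨hsum.integrable_sq, ?_⟩
  rcases Nat.eq_zero_or_pos n with rfl | hn
  · simp
  have hn' : (0 : ℝ) < n := by exact_mod_cast hn
  simp_rw [← sub_div, div_pow]
  rw [integral_div, div_le_div_iff₀ (by positivity) hn']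
  nlinarith

/-- Hoeffding's inequality for independent, not necessarily identically distributed variables,
applied to `F` and to `-F`. -/
theorem measureReal_abs_average_sub_ge_le (ρ : Fin n → Measure E) [∀ i, IsProbabilityMeasure (ρ i)]
    {F : E → ℝ} (hF : Measurable F) {C : ℝ} (hC : ∀ z, |F z| ≤ C) {ε : ℝ} (hε : 0 < ε) :
    (Measure.pi ρ).real {z | ε ≤ |(∑ i, F (z i)) / n - (∑ i, ∫ a, F a ∂(ρ i)) / n|}
      ≤ 2 * Real.exp (-(n * (ε ^ 2 / (2 * C ^ 2)))) := by
  -- For `n = 0` the right-hand side is `2`, so the bound is trivial.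
  rcases Nat.eq_zero_or_pos n with rfl | hn
  · refine measureReal_le_one.trans (by simp)
  have hn' : (0 : ℝ) < n := by exact_mod_cast hn
  have key : ∀ G : E → ℝ, Measurable G → (∀ z, |G z| ≤ C) →
      (Measure.pi ρ).real {z | n * ε ≤ ∑ i, (G (z i) - ∫ a, G a ∂(ρ i))}
        ≤ Real.exp (-(n * (ε ^ 2 / (2 * C ^ 2)))) := fun G hG hGC => by
    have hsub : ∀ i ∈ (Finset.univ : Finset (Fin n)),
        HasSubgaussianMGF (fun z : Fin n → E => G (z i) - ∫ a, G a ∂(ρ i))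
          ((‖C - -C‖₊ / 2) ^ 2) (Measure.pi ρ) := fun i _ => by
      -- Hoeffding's lemma on `[-C, C]`: the variance proxy is the squared half-length `C²`.
      have h := hasSubgaussianMGF_of_mem_Icc (μ := Measure.pi ρ) (X := fun z : Fin n → E => G (z i))
        (a := -C) (b := C) (hG.comp (measurable_pi_apply i)).aemeasurable (ae_of_all _ fun z => abs_le.1 (hGC (z i)))
      rwa [integral_comp_eval hG.aestronglyMeasurable] at h
    have hind := iIndepFun_pi (μ := ρ) (X := fun i a => G a - ∫ a, G a ∂(ρ i))
      fun i => by fun_prop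
    refine (HasSubgaussianMGF.measure_sum_ge_le_of_iIndepFun hind hsub
      (by positivity : (0 : ℝ) ≤ n * ε)).trans (Real.exp_le_exp.2 (le_of_eq ?_))
    have hc : ((∑ _i : Fin n, (‖C - -C‖₊ / 2) ^ 2 : NNReal) : ℝ) = n * C ^ 2 := by
      push_cast
      simp only [Real.norm_eq_abs, Finset.sum_const, Finset.card_univ,
        Fintype.card_fin, nsmul_eq_mul, div_pow, sq_abs]
      ring
    rw [hc]
    -- For `C = 0` both exponents are `0`, being quotients by zero.
    rcases eq_or_ne C 0 with rfl | hC0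
    · simp
    field_simp
  have hsplit : {z : Fin n → E | ε ≤ |(∑ i, F (z i)) / n - (∑ i, ∫ a, F a ∂(ρ i)) / n|} ⊆
      {z | n * ε ≤ ∑ i, (F (z i) - ∫ a, F a ∂(ρ i))} ∪
        {z | n * ε ≤ ∑ i, ((-F) (z i) - ∫ a, (-F) a ∂(ρ i))} := fun z hz => by
    simp only [Set.mem_ofPred_eq, Set.mem_union, Pi.neg_apply, integral_neg, Finset.sum_sub_distrib,
      Finset.sum_neg_distrib] at hz ⊢
    rw [← sub_div, abs_div, abs_of_pos hn', le_div_iff₀ hn', le_abs] at hz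
    rcases hz with h | h
    · left; linarith
    · right; linarith
  calc _ ≤ _ := measureReal_mono hsplit
    _ ≤ _ := measureReal_union_le _ _
    _ ≤ _ := add_le_add (key F hF hC) (key (-F) hF.neg fun z => by simpa using hC z)
    _ = _ := by ring

end Averages

/-! ### Conditional laws given by kernels -/

section CondLaw

variable {Ω E E' : Type*} {m : MeasurableSpace Ω} [mΩ : MeasurableSpace Ω] [MeasurableSpace E]
  [MeasurableSpace E'] {P : Measure Ω} [IsProbabilityMeasure P] {Z : Ω → E} {W : Ω → E'}

theorem HasCondLaw.measureReal_inter {ν : Ω → Measure E} (h : HasCondLaw P m Z ν) (hm : m ≤ mΩ)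
    (hZ : Measurable Z) {A : Set Ω} (hA : MeasurableSet[m] A) {B : Set E} (hB : MeasurableSet B) :
    P.real (A ∩ Z ⁻¹' B) = ∫ ω in A, (ν ω).real B ∂P := by
  have h1 : Integrable ((Z ⁻¹' B).indicator fun _ => (1 : ℝ)) P :=
    (integrable_const _).indicator (hZ hB)
  rw [← setIntegral_congr_ae (hm A hA) ((h B hB).mono fun ω hω _ => hω), setIntegral_condExp hm h1 hA,
    setIntegral_indicator (hZ hB)]
  simp

/-- Agreement on rectangles determines the joint law. This upgrades the conditional law from fixed
sets to test functions that also depend on the conditioning variable `W`. -/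
theorem HasCondLaw.map_prodMk {κ : Kernel E' E} [IsMarkovKernel κ]
    (h : HasCondLaw P m Z fun ω => κ (W ω)) (hm : m ≤ mΩ) (hW : Measurable[m] W)
    (hZ : Measurable Z) : P.map (fun ω => (W ω, Z ω)) = P.map W ⊗ₘ κ := by
  have hW' : Measurable W := hW.mono hm le_rfl
  have := Measure.isProbabilityMeasure_map (μ := P) (hW'.prodMk hZ).aemeasurable
  have := Measure.isProbabilityMeasure_map (μ := P) hW'.aemeasurable
  refine Measure.ext_prod fun {s t} hs ht => ?_
  rw [← ENNReal.toReal_eq_toReal_iff' (measure_ne_top _ _) (measure_ne_top _ _),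
    Measure.compProd_apply_prod hs ht, Measure.map_apply (hW'.prodMk hZ) (hs.prod ht),
    setLIntegral_map hs (κ.measurable_coe ht) hW']
  have h2 := h.measureReal_inter hm hZ (hW hs) ht
  simp only [measureReal_def] at h2
  rw [integral_toReal (f := fun ω => κ (W ω) t) ((κ.measurable_coe ht).comp hW').aemeasurable
    (ae_of_all _ fun ω => measure_lt_top _ _)] at h2
  exact h2

/-- Fubini for the joint law: a bound valid under `κ w` for every `w` passes to `P`. The mean-square
and tail bounds of the filter are transferred in this way. -/
theorem HasCondLaw.lintegral_le {κ : Kernel E' E} [IsMarkovKernel κ]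
    (h : HasCondLaw P m Z fun ω => κ (W ω)) (hm : m ≤ mΩ) (hW : Measurable[m] W)
    (hZ : Measurable Z) {Φ : E' → E → ℝ≥0∞} (hΦ : Measurable (Function.uncurry Φ)) {B : ℝ≥0∞}
    (hB : ∀ w, ∫⁻ z, Φ w z ∂(κ w) ≤ B) : ∫⁻ ω, Φ (W ω) (Z ω) ∂P ≤ B := by
  have hW' : Measurable W := hW.mono hm le_rfl
  have := Measure.isProbabilityMeasure_map (μ := P) hW'.aemeasurable
  calc ∫⁻ ω, Φ (W ω) (Z ω) ∂P = ∫⁻ p, Function.uncurry Φ p ∂(P.map fun ω => (W ω, Z ω)) :=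
        (lintegral_map hΦ (hW'.prodMk hZ)).symm
    _ = ∫⁻ w, ∫⁻ z, Φ w z ∂(κ w) ∂(P.map W) := by
        rw [h.map_prodMk hm hW hZ, Measure.lintegral_compProd hΦ]
        rfl
    _ ≤ ∫⁻ _, B ∂(P.map W) := lintegral_mono hB
    _ = B := by simp

theorem HasCondLaw.integral_sq_le {κ : Kernel E' E} [IsMarkovKernel κ]
    (h : HasCondLaw P m Z fun ω => κ (W ω)) (hm : m ≤ mΩ) (hW : Measurable[m] W)
    (hZ : Measurable Z) {Φ : E' → E → ℝ} (hΦ : Measurable (Function.uncurry Φ)) {B : ℝ}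
    (hB : ∀ w, Integrable (fun z => Φ w z ^ 2) (κ w) ∧ ∫ z, Φ w z ^ 2 ∂(κ w) ≤ B) :
    Integrable (fun ω => Φ (W ω) (Z ω) ^ 2) P ∧ ∫ ω, Φ (W ω) (Z ω) ^ 2 ∂P ≤ B := by
  have hW' : Measurable W := hW.mono hm le_rfl
  have hmeas : AEStronglyMeasurable (fun ω => Φ (W ω) (Z ω) ^ 2) P :=
    ((hΦ.comp (hW'.prodMk hZ)).pow_const 2).aestronglyMeasurable
  have key := h.lintegral_le hm hW hZ (Φ := fun w z => ENNReal.ofReal (Φ w z ^ 2))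
    (hΦ.pow_const 2).ennreal_ofReal (B := ENNReal.ofReal B) fun w => by
      rw [← ofReal_integral_eq_lintegral_ofReal (hB w).1 (ae_of_all _ fun _ => sq_nonneg _)]
      exact ENNReal.ofReal_le_ofReal (hB w).2
  have hB0 : 0 ≤ B := by
    obtain ⟨ω⟩ := P.nonempty_of_neZero
    exact (integral_nonneg fun _ => sq_nonneg _).trans (hB (W ω)).2
  refine ⟨⟨hmeas, ?_⟩, ?_⟩
  · rw [hasFiniteIntegral_iff_ofReal (ae_of_all _ fun _ => sq_nonneg _)]
    exact key.trans_lt ENNReal.ofReal_lt_top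
  · rw [integral_eq_lintegral_of_nonneg_ae (ae_of_all _ fun _ => sq_nonneg _) hmeas]
    exact ENNReal.toReal_le_of_le_ofReal hB0 key

theorem HasCondLaw.measureReal_ge_le {κ : Kernel E' E} [IsMarkovKernel κ]
    (h : HasCondLaw P m Z fun ω => κ (W ω)) (hm : m ≤ mΩ) (hW : Measurable[m] W)
    (hZ : Measurable Z) {Φ : E' → E → ℝ} (hΦ : Measurable (Function.uncurry Φ)) {ε B : ℝ}
    (hB : ∀ w, (κ w).real {z | ε ≤ |Φ w z|} ≤ B) :
    P.real {ω | ε ≤ |Φ (W ω) (Z ω)|} ≤ B := by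
  have hs : MeasurableSet {p : E' × E | ε ≤ |Φ p.1 p.2|} :=
    measurableSet_le measurable_const (by exact measurable_abs.comp hΦ)
  have hm' : Measurable (Function.uncurry fun w z => {p : E' × E | ε ≤ |Φ p.1 p.2|}.indicator
      (fun _ => (1 : ℝ≥0∞)) (w, z)) := measurable_const.indicator hs
  have hWZ : Measurable fun ω => (W ω, Z ω) := (hW.mono hm le_rfl).prodMk hZ
  have hB0 : 0 ≤ B := by
    obtain ⟨ω⟩ := P.nonempty_of_neZero
    exact measureReal_nonneg.trans (hB (W ω))
  refine ENNReal.toReal_le_of_le_ofReal hB0 ?_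
  have key := h.lintegral_le hm hW hZ hm' (B := ENNReal.ofReal B) fun w => by
    refine le_trans (le_of_eq (lintegral_indicator_one (measurable_prodMk_left hs))) ?_
    exact (ENNReal.ofReal_toReal (measure_ne_top _ _)).ge.trans (ENNReal.ofReal_le_ofReal (hB w))
  exact le_trans (le_of_eq (lintegral_indicator_one (hWZ hs)).symm) key

end CondLaw

/-! ### Convergence from exponential tail bounds, and weak convergence -/

section Limits

/-- Borel–Cantelli along the thresholds `1 / (k + 1)`; only the marginal law of each `D n` enters.
-/
theorem ae_tendsto_zero_of_exp_tail {Ω : Type*} [MeasurableSpace Ω] {P : Measure Ω}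
    [IsProbabilityMeasure P] {D : ℕ → Ω → ℝ} {c : ℝ} (hc : 0 < c)
    (h : ∀ n, 1 ≤ n → ∀ ε, 0 < ε →
      P.real {ω | ε ≤ |D n ω|} ≤ 2 * Real.exp (-(n * (ε ^ 2 / c)))) :
    ∀ᵐ ω ∂P, Tendsto (fun n => D n ω) atTop (𝓝 0) := by
  have key : ∀ k : ℕ, ∀ᵐ ω ∂P, ∀ᶠ n in atTop, |D n ω| < 1 / ((k : ℝ) + 1) := fun k => by
    set ε : ℝ := 1 / ((k : ℝ) + 1) with hε
    have hε0 : 0 < ε := by positivity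
    have hsum : Summable fun n : ℕ => 2 * Real.exp (-(((n : ℕ) : ℝ) * (ε ^ 2 / c))) := by
      refine Summable.mul_left 2 ?_
      have h1 : Real.exp (-(ε ^ 2 / c)) < 1 := Real.exp_lt_one_iff.2 (neg_lt_zero.2 (by positivity))
      refine (summable_geometric_of_lt_one (Real.exp_nonneg _) h1).congr fun n => ?_
      rw [← Real.exp_nat_mul]
      congr 1
      ring
    have hfin : ∑' n : ℕ, P {ω | ε ≤ |D n ω|} ≠ ∞ := by
      refine ne_top_of_le_ne_top hsum.tsum_ofReal_ne_top (ENNReal.tsum_le_tsum fun n => ?_)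
      rw [← ofReal_measureReal]
      refine ENNReal.ofReal_le_ofReal ?_
      rcases Nat.eq_zero_or_pos n with rfl | hn
      · exact measureReal_le_one.trans (by simp)
      · exact h n hn ε hε0
    filter_upwards [ae_eventually_notMem hfin] with ω hω
    filter_upwards [hω] with n hn
    simpa using hn
  filter_upwards [ae_all_iff.2 key] with ω hω
  rw [Metric.tendsto_atTop]
  intro ε hε
  obtain ⟨k, hk⟩ := exists_nat_one_div_lt hε
  obtain ⟨N, hN⟩ := eventually_atTop.1 (hω k)
  exact ⟨N, fun n hn => by simpa using (hN n hn).trans hk⟩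

variable {Ω S : Type*} [MeasurableSpace Ω] [MeasurableSpace S]

/-- The random measures `μⁿ` converge to `ν` almost surely on each bounded measurable function. -/
def ConvergesPointwise (P : Measure Ω) (μ : ℕ → Ω → Measure S) (ν : Ω → Measure S) : Prop :=
  ∀ f : S → ℝ, Measurable f → (∃ C, ∀ x, |f x| ≤ C) →
    ∀ᵐ ω ∂P, Tendsto (fun n => ∫ x, f x ∂(μ n ω)) atTop (𝓝 (∫ x, f x ∂(ν ω)))

/-- Dominated convergence, with the constant `2C` as dominating function. -/
theorem ConvergesPointwise.convergesInExpectation {P : Measure Ω} [IsProbabilityMeasure P]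
    {μ : ℕ → Ω → Measure S} {ν : Ω → Measure S} (h : ConvergesPointwise P μ ν)
    (hμ : ∀ n, 1 ≤ n → ∀ ω, IsProbabilityMeasure (μ n ω))
    (hν : ∀ᵐ ω ∂P, IsProbabilityMeasure (ν ω))
    (hμm : ∀ f : S → ℝ, Measurable f → ∀ n, 1 ≤ n → Measurable fun ω => ∫ x, f x ∂(μ n ω))
    (hνm : ∀ f : S → ℝ, Measurable f → Measurable fun ω => ∫ x, f x ∂(ν ω)) :
    ConvergesInExpectation P μ ν := by
  rintro f hf ⟨C, hC⟩
  have hbd : ∀ n, 1 ≤ n → ∀ᵐ ω ∂P, ‖|∫ x, f x ∂(μ n ω) - ∫ x, f x ∂(ν ω)|‖ ≤ C + C :=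
    fun n hn => by
      filter_upwards [hν] with ω hω
      have := hμ n hn ω
      rw [Real.norm_eq_abs, abs_abs]
      refine (abs_sub _ _).trans (add_le_add ?_ ?_)
      · simpa using norm_integral_le_of_norm_le_const (μ := μ n ω) (f := f) (C := C)
          (ae_of_all _ hC)
      · simpa using norm_integral_le_of_norm_le_const (μ := ν ω) (f := f) (C := C)
          (ae_of_all _ hC)
  have hmeas : ∀ n, 1 ≤ n →
      AEStronglyMeasurable (fun ω => |∫ x, f x ∂(μ n ω) - ∫ x, f x ∂(ν ω)|) P := fun n hn =>
    (measurable_abs.comp ((hμm f hf n hn).sub (hνm f hf))).aestronglyMeasurable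
  refine ⟨fun n hn => Integrable.of_bound (hmeas n hn) _ (hbd n hn), ?_⟩
  -- The index is shifted because `hμ` and `hμm` only cover `n ≥ 1`; an empirical measure of no
  -- particles is not a probability measure.
  rw [← tendsto_add_atTop_iff_nat 1]
  have := tendsto_integral_of_dominated_convergence (μ := P) (f := fun _ => (0 : ℝ))
    (F := fun n ω => |∫ x, f x ∂(μ (n + 1) ω) - ∫ x, f x ∂(ν ω)|) (fun _ => C + C)
    (fun n => hmeas _ (by omega)) (integrable_const _) (fun n => hbd _ (by omega)) (by
      filter_upwards [h f hf ⟨C, hC⟩] with ω hω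
      have h1 := ((tendsto_add_atTop_iff_nat 1).2 hω).sub_const (∫ x, f x ∂(ν ω))
      simpa using h1.abs)
  simpa using this

/-- An open `G` is a directed union of finite unions of basic open sets, so convergence on those
unions forces `ν G ≤ liminf μ n G`, the portmanteau criterion. The finite unions form a countable
class. -/
theorem tendsto_integral_of_tendsto_finite_unions [TopologicalSpace S] [SecondCountableTopology S]
    [TopologicalSpace.PseudoMetrizableSpace S] [BorelSpace S] {μ : ℕ → Measure S} {ν : Measure S}
    [∀ n, IsProbabilityMeasure (μ n)] [IsProbabilityMeasure ν]
    (h : ∀ F : Finset (TopologicalSpace.countableBasis S),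
      Tendsto (fun n => μ n (⋃ U ∈ F, (U : Set S))) atTop (𝓝 (ν (⋃ U ∈ F, (U : Set S)))))
    (f : S →ᵇ ℝ) : Tendsto (fun n => ∫ x, f x ∂(μ n)) atTop (𝓝 (∫ x, f x ∂ν)) := by
  have := tendsto_of_forall_isOpen_le_liminf_nat' (μ := (⟨ν, ‹_›⟩ : ProbabilityMeasure S))
    (μs := fun n => (⟨μ n, inferInstance⟩ : ProbabilityMeasure S)) fun G hG => by
      simp only [ProbabilityMeasure.coe_mk]
      obtain ⟨T, hT, hGT⟩ := (TopologicalSpace.isBasis_countableBasis S).open_eq_sUnion hG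
      have hG' : G = ⋃ U : {U : TopologicalSpace.countableBasis S // (U : Set S) ∈ T},
          (U.1 : Set S) := by
        rw [hGT]
        ext x
        simp only [Set.mem_sUnion, Set.mem_iUnion, Subtype.exists, exists_prop]
        exact ⟨fun ⟨U, hU, hx⟩ => ⟨U, hT hU, hU, hx⟩, fun ⟨U, _, hU, hx⟩ => ⟨U, hU, hx⟩⟩
      have hsup : ν G = ⨆ F : Finset {U : TopologicalSpace.countableBasis S // (U : Set S) ∈ T},
          ν (⋃ U ∈ F, (U.1 : Set S)) := by
        have := (TopologicalSpace.countable_countableBasis S).to_subtype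
        conv_lhs => rw [hG', Set.iUnion_eq_iUnion_finset]
        refine Directed.measure_iUnion (Monotone.directed_le fun F F' hF => ?_)
        exact Set.biUnion_subset_biUnion_left hF
      rw [hsup]
      refine iSup_le fun F => ?_
      classical
      have h1 := h (F.image Subtype.val)
      rw [Finset.set_biUnion_finset_image] at h1
      rw [← h1.liminf_eq]
      refine liminf_le_liminf (Eventually.of_forall fun n => measure_mono ?_)
      rw [hG']
      exact Set.iUnion₂_subset fun U _ => Set.subset_iUnion_of_subset U subset_rfl
  simpa using (ProbabilityMeasure.tendsto_iff_forall_integral_tendsto.1 this) f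

/-- The exceptional null set of pointwise convergence depends on `f`. Testing only on the countably
many finite unions of basic open sets leaves a single null set, outside which weak convergence
holds. -/
theorem ConvergesPointwise.convergesAlmostSurely [TopologicalSpace S] [SecondCountableTopology S]
    [TopologicalSpace.PseudoMetrizableSpace S] [BorelSpace S] {P : Measure Ω}
    {μ : ℕ → Ω → Measure S} {ν : Ω → Measure S} (h : ConvergesPointwise P μ ν)
    (hμ : ∀ n, 1 ≤ n → ∀ ω, IsProbabilityMeasure (μ n ω))
    (hν : ∀ᵐ ω ∂P, IsProbabilityMeasure (ν ω)) : ConvergesAlmostSurely P μ ν := by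
  have : Countable (TopologicalSpace.countableBasis S) :=
    (TopologicalSpace.countable_countableBasis S).to_subtype
  have hopen : ∀ F : Finset (TopologicalSpace.countableBasis S),
      MeasurableSet (⋃ U ∈ F, (U : Set S)) := fun F =>
    (isOpen_biUnion fun U _ => TopologicalSpace.isOpen_of_mem_countableBasis U.2).measurableSet
  have hall : ∀ᵐ ω ∂P, ∀ F : Finset (TopologicalSpace.countableBasis S),
      Tendsto (fun n => ∫ x, (⋃ U ∈ F, (U : Set S)).indicator 1 x ∂(μ n ω)) atTop
        (𝓝 (∫ x, (⋃ U ∈ F, (U : Set S)).indicator (1 : S → ℝ) x ∂(ν ω))) :=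
    ae_all_iff.2 fun F => h _ (measurable_one.indicator (hopen F))
      ⟨1, fun x => by simp only [Set.indicator]; split_ifs <;> simp⟩
  filter_upwards [hall, hν] with ω hω hνω f
  rw [← tendsto_add_atTop_iff_nat 1]
  have := fun n => hμ (n + 1) (by omega) ω
  refine tendsto_integral_of_tendsto_finite_unions (μ := fun n => μ (n + 1) ω) (fun F => ?_) f
  have h1 := (tendsto_add_atTop_iff_nat 1).2 (hω F)
  simp only [integral_indicator_one (hopen F), measureReal_def] at h1
  exact (ENNReal.tendsto_toReal_iff (fun _ => measure_ne_top _ _) (measure_ne_top _ _)).1 h1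

end Limits

/-! ### The Bayesian recursion -/

section Recursion

variable {S : Type*} [MeasurableSpace S]

theorem integral_bind_kernel {E : Type*} [MeasurableSpace E] (p : Measure S) [IsFiniteMeasure p]
    (κ : Kernel S E) [IsMarkovKernel κ] {f : E → ℝ} (hf : Measurable f)
    (hfb : ∃ C, ∀ x, |f x| ≤ C) : ∫ x, f x ∂(p.bind κ) = ∫ x, ∫ z, f z ∂(κ x) ∂p := by
  obtain ⟨C, hC⟩ := hfb
  rw [← Measure.snd_compProd, Measure.snd, integral_map measurable_snd.aemeasurable
    hf.aestronglyMeasurable]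
  exact Measure.integral_compProd (f := fun q : S × E => f q.2)
    (Integrable.of_bound (hf.comp measurable_snd).aestronglyMeasurable C (ae_of_all _ fun _ => hC _))

theorem measurable_integral_kernel {E : Type*} [MeasurableSpace E] (κ : Kernel S E)
    [IsMarkovKernel κ] {f : E → ℝ} (hf : Measurable f) : Measurable fun x => ∫ z, f z ∂(κ x) :=
  (hf.stronglyMeasurable.integral_kernel).measurable

theorem abs_integral_le_of_bound {E : Type*} [MeasurableSpace E] (μ : Measure E)
    [IsProbabilityMeasure μ] {f : E → ℝ} {C : ℝ} (hC : ∀ x, |f x| ≤ C) : |∫ x, f x ∂μ| ≤ C := by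
  simpa using norm_integral_le_of_norm_le_const (μ := μ) (f := f) (C := C) (ae_of_all _ hC)

/-- The sign of `c` is free: this covers `b < 0`, where `ρ₀` is negative. -/
theorem bayesUpdate_const_mul {c : ℝ} (hc : c ≠ 0) (g : S → ℝ) (p : Measure S) :
    bayesUpdate (fun x => c * g x) p = bayesUpdate g p := by
  simp only [bayesUpdate, integral_const_mul, mul_div_mul_left _ _ hc]

theorem posterior_const_mul {c : ℝ} (hc : c ≠ 0) (prior : Measure S) (K : ℕ → Kernel S S)
    (g : Fin 2 → S → ℝ) (y : ℕ → Fin 2) (t : ℕ) :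
    posterior prior K (fun i x => c * g i x) y t = posterior prior K g y t := by
  induction t with
  | zero => rfl
  | succ t ih => simp only [posterior, ih, bayesUpdate_const_mul hc]

/-- Makes the posterior a function on a finite set of records, hence measurable and constant on each
record event. -/
theorem posterior_congr {prior : Measure S} {K : ℕ → Kernel S S} {g : Fin 2 → S → ℝ}
    {y y' : ℕ → Fin 2} {t : ℕ} (h : ∀ r ∈ Finset.Icc 1 t, y r = y' r) :
    posterior prior K g y t = posterior prior K g y' t := by
  induction t with
  | zero => rfl
  | succ t ih =>
    rw [posterior, posterior, ih fun r hr => h r (Finset.Icc_subset_Icc le_rfl t.le_succ hr),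
      h (t + 1) (by simp)]

variable {g : S → ℝ}

theorem bayesUpdate_eq_zero {p : Measure S} (h : ∫ z, g z ∂p = 0) : bayesUpdate g p = 0 := by
  simp only [bayesUpdate, h, div_zero, ENNReal.ofReal_zero]
  exact withDensity_zero

/-- If the normalizing constant vanishes, both sides are `0` by the division convention. -/
theorem integral_bayesUpdate (hg : Measurable g) (hg0 : ∀ x, 0 ≤ g x) (p : Measure S) (f : S → ℝ) :
    ∫ x, f x ∂(bayesUpdate g p) = (∫ x, g x * f x ∂p) / ∫ x, g x ∂p := by
  rw [bayesUpdate, integral_withDensity_eq_integral_toReal_smul (by fun_prop)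
    (ae_of_all _ fun _ => ENNReal.ofReal_lt_top), ← integral_div]
  refine integral_congr_ae (ae_of_all _ fun x => ?_)
  simp only [smul_eq_mul]
  rw [ENNReal.toReal_ofReal (div_nonneg (hg0 x) (integral_nonneg hg0))]
  ring

theorem isProbabilityMeasure_bayesUpdate {p : Measure S} (hg0 : ∀ x, 0 ≤ g x)
    (hg : Integrable g p) (h : ∫ z, g z ∂p ≠ 0) : IsProbabilityMeasure (bayesUpdate g p) := by
  constructor
  rw [bayesUpdate, withDensity_apply _ .univ, Measure.restrict_univ,
    ← ofReal_integral_eq_lintegral_ofReal (hg.div_const _)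
      (ae_of_all _ fun x => div_nonneg (hg0 x) (integral_nonneg hg0)), integral_div, div_self h,
    ENNReal.ofReal_one]

variable {prior : Measure S} [IsProbabilityMeasure prior] {K : ℕ → Kernel S S}
  [∀ t, IsMarkovKernel (K t)] {g : Fin 2 → S → ℝ}

theorem integrable_of_measurable_of_bound {g : S → ℝ} (hg : Measurable g) (hgb : ∃ C, ∀ x, |g x| ≤ C)
    (p : Measure S) [IsFiniteMeasure p] : Integrable g p :=
  hgb.elim fun C hC => Integrable.of_bound hg.aestronglyMeasurable C (ae_of_all _ hC)

/-- A vanishing normalizing constant turns the update into the zero measure, and all later updates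
stay zero; exceptional records thus remain under control without excluding them. -/
theorem isZeroOrProbabilityMeasure_posterior (hg : ∀ i, Measurable (g i)) (hg0 : ∀ i x, 0 ≤ g i x)
    (hgb : ∀ i, ∃ C, ∀ x, |g i x| ≤ C) (y : ℕ → Fin 2) (t : ℕ) :
    IsZeroOrProbabilityMeasure (posterior prior K g y t) := by
  induction t with
  | zero => rw [posterior]; infer_instance
  | succ t ih =>
    rw [posterior]
    by_cases h : ∫ z, g (y (t + 1)) z ∂((posterior prior K g y t).bind (K t)) = 0
    · rw [bayesUpdate_eq_zero h]
      infer_instance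
    · have := isProbabilityMeasure_bayesUpdate (hg0 _)
        (integrable_of_measurable_of_bound (hg _) (hgb _) _) h
      infer_instance

theorem isProbabilityMeasure_posterior (hg : ∀ i, Measurable (g i)) (hg0 : ∀ i x, 0 ≤ g i x)
    (hgb : ∀ i, ∃ C, ∀ x, |g i x| ≤ C) {y : ℕ → Fin 2}
    (h : ∀ t, ∫ z, g (y (t + 1)) z ∂(predictive prior K g y t) ≠ 0) (t : ℕ) :
    IsProbabilityMeasure (posterior prior K g y t) := by
  induction t with
  | zero => rw [posterior]; infer_instance
  | succ t ih =>
    rw [posterior]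
    exact isProbabilityMeasure_bayesUpdate (hg0 _)
      (integrable_of_measurable_of_bound (hg _) (hgb _) _) (h t)

end Recursion

/-! ### Empirical measures and resampling weights -/

section Particles

variable {S : Type*} [MeasurableSpace S] {n : ℕ}

theorem isProbabilityMeasure_empirical (hn : 1 ≤ n) (x : Fin n → S) :
    IsProbabilityMeasure (empirical x) := by
  constructor
  simp only [empirical, Measure.smul_apply, Measure.finsetSum_apply, measure_univ,
    Finset.sum_const, Finset.card_univ, Fintype.card_fin, smul_eq_mul, nsmul_eq_mul, mul_one]
  exact ENNReal.inv_mul_cancel (by exact_mod_cast (by omega : n ≠ 0)) (ENNReal.natCast_ne_top n)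

theorem integral_empirical (x : Fin n → S) {f : S → ℝ} (hf : Measurable f) :
    ∫ z, f z ∂(empirical x) = (∑ i, f (x i)) / n := by
  rw [empirical, integral_smul_measure, integral_finsetSum_measure fun i _ =>
    integrable_dirac' hf.stronglyMeasurable (by simp)]
  simp only [integral_dirac' _ _ hf.stronglyMeasurable, ENNReal.toReal_inv, ENNReal.toReal_natCast,
    smul_eq_mul]
  ring

theorem integral_weightedEmpirical {G : Fin n → ℝ} (hG : ∀ i, 0 ≤ G i) (x : Fin n → S) {f : S → ℝ}
    (hf : Measurable f) : ∫ z, f z ∂(weightedEmpirical G x) = ∑ i, G i * f (x i) := by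
  rw [weightedEmpirical, integral_finsetSum_measure fun i _ =>
    (integrable_dirac' hf.stronglyMeasurable (by simp)).smul_measure ENNReal.ofReal_ne_top]
  refine Finset.sum_congr rfl fun i _ => ?_
  rw [integral_smul_measure, integral_dirac' _ _ hf.stronglyMeasurable,
    ENNReal.toReal_ofReal (hG i), smul_eq_mul]

theorem isProbabilityMeasure_weightedEmpirical {G : Fin n → ℝ} (hG : ∀ i, 0 ≤ G i)
    (hG1 : ∑ i, G i = 1) (x : Fin n → S) : IsProbabilityMeasure (weightedEmpirical G x) := by
  constructor
  simp only [weightedEmpirical, Measure.finsetSum_apply, Measure.smul_apply, measure_univ,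
    smul_eq_mul, mul_one]
  rw [← ENNReal.ofReal_sum_of_nonneg fun i _ => hG i, hG1, ENNReal.ofReal_one]

omit [MeasurableSpace S] in
theorem weights_const_mul {c : ℝ} (hc : c ≠ 0) (g : S → ℝ) (x : Fin n → S) :
    weights (fun z => c * g z) x = weights g x := by
  ext i
  simp only [weights, ← Finset.mul_sum, mul_eq_zero, hc, false_or, mul_div_mul_left _ _ hc]

omit [MeasurableSpace S] in
theorem weights_nonneg {g : S → ℝ} (hg0 : ∀ z, 0 ≤ g z) (x : Fin n → S) (i : Fin n) :
    0 ≤ weights g x i := by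
  rw [weights]
  split_ifs
  · positivity
  · exact div_nonneg (hg0 _) (Finset.sum_nonneg fun j _ => hg0 _)

omit [MeasurableSpace S] in
theorem sum_weights (hn : 1 ≤ n) (g : S → ℝ) (x : Fin n → S) : ∑ i, weights g x i = 1 := by
  have hn' : (n : ℝ) ≠ 0 := by exact_mod_cast (by omega : n ≠ 0)
  simp only [weights]
  split_ifs with h
  · simp [hn']
  · rw [← Finset.sum_div, div_self h]

/-- The weighted measure is the Bayes update of the empirical measure, as long as `h` excludes the
fallback weights `1 / n`. -/
theorem integral_weightedEmpirical_weights {g : S → ℝ} (hg : Measurable g) (hg0 : ∀ z, 0 ≤ g z)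
    {f : S → ℝ} (hf : Measurable f) (x : Fin n → S) (h : ∫ z, g z ∂(empirical x) ≠ 0) :
    ∫ z, f z ∂(weightedEmpirical (weights g x) x)
      = (∫ z, g z * f z ∂(empirical x)) / ∫ z, g z ∂(empirical x) := by
  rw [integral_empirical _ hg] at h
  rw [integral_weightedEmpirical (weights_nonneg hg0 x) x hf, integral_empirical (f := fun z => g z * f z) _ (hg.mul hf),
    integral_empirical _ hg]
  obtain ⟨h1, h2⟩ := div_ne_zero_iff.1 h
  rw [div_div_div_cancel_right₀ h2, Finset.sum_div]
  refine Finset.sum_congr rfl fun i _ => ?_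
  rw [weights, if_neg h1]
  ring

theorem measurable_weights {g : Fin 2 → S → ℝ} (hg : ∀ y, Measurable (g y)) (i : Fin n) :
    Measurable fun w : Fin 2 × (Fin n → S) => weights (g w.1) w.2 i := by
  refine measurable_from_prod_countable_right fun y => ?_
  have h1 : Measurable fun x : Fin n → S => ∑ j, g y (x j) :=
    Finset.measurable_sum _ fun j _ => (hg y).comp (measurable_pi_apply j)
  exact Measurable.ite (h1 (measurableSet_singleton 0)) measurable_const
    (((hg y).comp (measurable_pi_apply i)).div h1)

theorem isProbabilityMeasure_mutation_law (hn : 1 ≤ n) (κ : Kernel S S) [IsMarkovKernel κ]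
    (mutation : Mutation) (x : Fin n → S) (i : Fin n) :
    IsProbabilityMeasure (mutation.law κ x i) := by
  have := isProbabilityMeasure_empirical hn x
  cases mutation <;> rw [Mutation.law] <;> infer_instance

/-- Both ways of moving the particles have the same averaged mean. Together with independence this
is all that the error bounds need, so they treat both at once. -/
theorem average_integral_mutation_law (hn : 1 ≤ n) (κ : Kernel S S) [IsMarkovKernel κ]
    (mutation : Mutation) (x : Fin n → S) {f : S → ℝ} (hf : Measurable f)
    (hfb : ∃ C, ∀ z, |f z| ≤ C) :
    (∑ i, ∫ z, f z ∂(mutation.law κ x i)) / n = ∫ z, ∫ z', f z' ∂(κ z) ∂(empirical x) := by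
  have := isProbabilityMeasure_empirical hn x
  have hn' : (n : ℝ) ≠ 0 := by exact_mod_cast (by omega : n ≠ 0)
  cases mutation
  · simp only [Mutation.law, Finset.sum_const, Finset.card_univ, Fintype.card_fin, nsmul_eq_mul]
    rw [mul_div_cancel_left₀ _ hn', integral_bind_kernel _ _ hf hfb]
  · rw [integral_empirical _ (measurable_integral_kernel κ hf)]
    rfl

theorem measurable_pi_measure {α E : Type*} [MeasurableSpace α] [MeasurableSpace E]
    {ρ : α → Fin n → Measure E} [∀ a i, IsProbabilityMeasure (ρ a i)]
    (hρ : ∀ i, Measurable fun a => ρ a i) : Measurable fun a => Measure.pi (ρ a) := by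
  refine Measurable.measure_of_isPiSystem_of_isProbabilityMeasure generateFrom_pi.symm
    isPiSystem_pi ?_
  rintro _ ⟨t, ht, rfl⟩
  simp only [Measure.pi_pi]
  exact Finset.measurable_prod _ fun i _ => (Measure.measurable_coe (ht i trivial)).comp (hρ i)

theorem measurable_empirical : Measurable (empirical : (Fin n → S) → Measure S) := by
  refine Measure.measurable_of_measurable_coe _ fun s hs => ?_
  simp only [empirical, Measure.smul_apply, Measure.finsetSum_apply, smul_eq_mul]
  refine Measurable.const_mul (Finset.measurable_sum _ fun i _ => ?_) _
  exact (Measure.measurable_coe hs).comp (Measure.measurable_dirac.comp (measurable_pi_apply i))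

theorem measurable_mutation_law (κ : Kernel S S) (mutation : Mutation) (i : Fin n) :
    Measurable fun x : Fin n → S => mutation.law κ x i := by
  cases mutation
  · exact (Measure.measurable_bind' κ.measurable).comp measurable_empirical
  · exact κ.measurable.comp (measurable_pi_apply i)

/-- The joint law of the moved particles, as a kernel. -/
noncomputable def moveKernel (hn : 1 ≤ n) (κ : Kernel S S) [IsMarkovKernel κ] (mutation : Mutation) :
    Kernel (Fin n → S) (Fin n → S) where
  toFun x := Measure.pi fun i => mutation.law κ x i
  measurable' := by
    have := isProbabilityMeasure_mutation_law hn κ mutation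
    exact measurable_pi_measure (ρ := fun x i => mutation.law κ x i)
      (measurable_mutation_law κ mutation)

instance (hn : 1 ≤ n) (κ : Kernel S S) [IsMarkovKernel κ] (mutation : Mutation) :
    IsMarkovKernel (moveKernel hn κ mutation) where
  isProbabilityMeasure x := by
    have := isProbabilityMeasure_mutation_law hn κ mutation
    exact inferInstanceAs (IsProbabilityMeasure (Measure.pi fun i => mutation.law κ x i))

theorem measurable_offspring (n : ℕ) :
    Measurable fun (a : Fin n → Fin n) j => (Finset.univ.filter fun i => a i = j).card :=
  measurable_of_finite _

/-- The law of a single draw from the cells `1, …, n` with probabilities `Gⱼ`. -/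
noncomputable def cellLaw (G : Fin n → ℝ) : Measure (Fin n) := ∑ j, ENNReal.ofReal (G j) • Measure.dirac j

theorem isProbabilityMeasure_cellLaw {G : Fin n → ℝ} (hG : ∀ i, 0 ≤ G i) (hG1 : ∑ i, G i = 1) :
    IsProbabilityMeasure (cellLaw G) :=
  isProbabilityMeasure_weightedEmpirical hG hG1 id

theorem integral_cellLaw {G : Fin n → ℝ} (hG : ∀ i, 0 ≤ G i) (F : Fin n → ℝ) :
    ∫ a, F a ∂(cellLaw G) = ∑ j, G j * F j :=
  integral_weightedEmpirical hG id (measurable_of_finite F)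

theorem multinomialLaw_eq_map (G : Fin n → ℝ) :
    multinomialLaw G = (Measure.pi fun _ : Fin n => cellLaw G).map
      fun (a : Fin n → Fin n) j => (Finset.univ.filter fun i => a i = j).card := rfl

theorem isProbabilityMeasure_multinomialLaw {G : Fin n → ℝ} (hG : ∀ i, 0 ≤ G i)
    (hG1 : ∑ i, G i = 1) : IsProbabilityMeasure (multinomialLaw G) := by
  have := isProbabilityMeasure_cellLaw hG hG1
  rw [multinomialLaw_eq_map]
  exact Measure.isProbabilityMeasure_map (measurable_offspring n).aemeasurable

theorem measurable_multinomialLaw {α : Type*} [MeasurableSpace α] {G : α → Fin n → ℝ}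
    (hGm : ∀ i, Measurable fun a => G a i) (hG : ∀ a i, 0 ≤ G a i) (hG1 : ∀ a, ∑ i, G a i = 1) :
    Measurable fun a => multinomialLaw (G a) := by
  have := fun a => isProbabilityMeasure_cellLaw (hG a) (hG1 a)
  simp_rw [multinomialLaw_eq_map]
  refine (Measure.measurable_map _ (measurable_offspring n)).comp
    (measurable_pi_measure (ρ := fun a _ => cellLaw (G a)) fun _ => ?_)
  refine Measure.measurable_of_measurable_coe _ fun s _ => ?_
  simp only [cellLaw, Measure.finsetSum_apply, Measure.smul_apply, smul_eq_mul]
  exact Finset.measurable_sum _ fun i _ => (hGm i).ennreal_ofReal.mul_const _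

/-- The law of the offspring numbers given the outcome and the moved particles, as a kernel. -/
noncomputable def offspringKernel (hn : 1 ≤ n) {g : Fin 2 → S → ℝ} (hg : ∀ y, Measurable (g y))
    (hg0 : ∀ y z, 0 ≤ g y z) : Kernel (Fin 2 × (Fin n → S)) (Fin n → ℕ) where
  toFun w := multinomialLaw (weights (g w.1) w.2)
  measurable' := measurable_multinomialLaw (measurable_weights hg)
    (fun w => weights_nonneg (hg0 w.1) w.2) fun w => sum_weights hn (g w.1) w.2

instance (hn : 1 ≤ n) {g : Fin 2 → S → ℝ} (hg : ∀ y, Measurable (g y)) (hg0 : ∀ y z, 0 ≤ g y z) :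
    IsMarkovKernel (offspringKernel hn hg hg0) where
  isProbabilityMeasure w :=
    isProbabilityMeasure_multinomialLaw (weights_nonneg (hg0 w.1) w.2) (sum_weights hn (g w.1) w.2)

/-- Grouping the draws by cell turns multinomial counts back into a sum over independent draws, to
which the bounds for averages apply. -/
theorem sum_offspring_mul (a : Fin n → Fin n) (F : Fin n → ℝ) :
    ∑ j, ((Finset.univ.filter fun i => a i = j).card : ℝ) * F j = ∑ i, F (a i) := by
  rw [← Finset.sum_fiberwise' Finset.univ a F]
  simp

theorem measurable_multinomial_deviation (G F : Fin n → ℝ) :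
    Measurable fun k : Fin n → ℕ => (∑ j, (k j : ℝ) * F j) / n - ∑ j, G j * F j :=
  measurable_of_countable _

theorem multinomial_deviation_offspring {G : Fin n → ℝ} (hn : 1 ≤ n) (hG : ∀ i, 0 ≤ G i)
    (F : Fin n → ℝ) (a : Fin n → Fin n) :
    (∑ j, ((Finset.univ.filter fun i => a i = j).card : ℝ) * F j) / n - ∑ j, G j * F j
      = (∑ i, F (a i)) / n - (∑ _i : Fin n, ∫ b, F b ∂(cellLaw G)) / n := by
  have hn' : (n : ℝ) ≠ 0 := by exact_mod_cast (by omega : n ≠ 0)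
  rw [sum_offspring_mul, integral_cellLaw hG, Finset.sum_const, Finset.card_univ,
    Fintype.card_fin, nsmul_eq_mul, mul_div_cancel_left₀ _ hn']

theorem integral_sq_multinomial_le {G : Fin n → ℝ} (hn : 1 ≤ n) (hG : ∀ i, 0 ≤ G i)
    (hG1 : ∑ i, G i = 1) {F : Fin n → ℝ} {C : ℝ} (hC : ∀ j, |F j| ≤ C) :
    Integrable (fun k : Fin n → ℕ => ((∑ j, (k j : ℝ) * F j) / n - ∑ j, G j * F j) ^ 2)
        (multinomialLaw G) ∧
      ∫ k, ((∑ j, (k j : ℝ) * F j) / n - ∑ j, G j * F j) ^ 2 ∂(multinomialLaw G) ≤ C ^ 2 / n := by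
  have := isProbabilityMeasure_cellLaw hG hG1
  have hm := ((measurable_multinomial_deviation G F).pow_const 2).aestronglyMeasurable
    (μ := multinomialLaw G)
  rw [multinomialLaw_eq_map] at hm ⊢
  rw [integrable_map_measure hm (measurable_offspring n).aemeasurable,
    integral_map (measurable_offspring n).aemeasurable hm, Function.comp_def]
  simp_rw [multinomial_deviation_offspring hn hG]
  exact integral_sq_average_sub_le _ (measurable_of_finite F) hC

theorem measureReal_abs_multinomial_ge_le {G : Fin n → ℝ} (hn : 1 ≤ n) (hG : ∀ i, 0 ≤ G i)
    (hG1 : ∑ i, G i = 1) {F : Fin n → ℝ} {C : ℝ} (hC : ∀ j, |F j| ≤ C) {ε : ℝ} (hε : 0 < ε) :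
    (multinomialLaw G).real {k | ε ≤ |(∑ j, (k j : ℝ) * F j) / n - ∑ j, G j * F j|}
      ≤ 2 * Real.exp (-(n * (ε ^ 2 / (2 * C ^ 2)))) := by
  have := isProbabilityMeasure_cellLaw hG hG1
  rw [multinomialLaw_eq_map, map_measureReal_apply (measurable_offspring n)
    (measurableSet_le measurable_const (measurable_multinomial_deviation G F).abs),
    Set.preimage_ofPred_eq]
  simp_rw [multinomial_deviation_offspring hn hG]
  exact measureReal_abs_average_sub_ge_le _ (measurable_of_finite F) hC hε

end Particles

/-! ### Mean-square and tail bounds for the steps of the bootstrap filter -/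

/-! ### Measurability with respect to the history of a process and to finite records -/

section SigmaGen

variable {Ω E : Type*} [mΩ : MeasurableSpace Ω] [MeasurableSpace E] {I : Finset ℕ} {Z : ℕ → Ω → E}

omit mΩ in
theorem measurable_sigmaGen {s : ℕ} (hs : s ∈ I) : Measurable[sigmaGen I Z] (Z s) :=
  (comap_measurable (Z s)).mono (le_iSup₂_of_le s hs le_rfl) le_rfl

theorem sigmaGen_le (hZ : ∀ s, Measurable (Z s)) (I : Finset ℕ) : sigmaGen I Z ≤ mΩ :=
  iSup₂_le fun s _ => (hZ s).comap_le

/-- A record of the outcomes at the times `1, …, t`, extended by `0` to all times. -/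
def extendRecord {t : ℕ} (u : Finset.Icc 1 t → Fin 2) (r : ℕ) : Fin 2 :=
  if hr : r ∈ Finset.Icc 1 t then u ⟨r, hr⟩ else 0

theorem extendRecord_restrict {t : ℕ} (y : ℕ → Fin 2) {r : ℕ} (hr : r ∈ Finset.Icc 1 t) :
    extendRecord (fun r : Finset.Icc 1 t => y r) r = y r := dif_pos hr

omit mΩ in
theorem measurable_record (Y : ℕ → Ω → Fin 2) (t : ℕ) :
    Measurable[sigmaGen (Finset.Icc 1 t) Y] fun ω (r : Finset.Icc 1 t) => Y r ω :=
  @measurable_pi_lambda _ _ _ (sigmaGen (Finset.Icc 1 t) Y) _ _ fun r => measurable_sigmaGen r.2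

omit mΩ in
-- The functional factors through the finite set of records up to time `t`, on which every function
-- is measurable.
theorem measurable_record_functional {Y : ℕ → Ω → Fin 2} {t : ℕ} {β : Type*}
    [MeasurableSpace β] {Ψ : (ℕ → Fin 2) → β}
    (hΨ : ∀ y y' : ℕ → Fin 2, (∀ r ∈ Finset.Icc 1 t, y r = y' r) → Ψ y = Ψ y') :
    Measurable[sigmaGen (Finset.Icc 1 t) Y] fun ω => Ψ fun r => Y r ω := by
  have h : Measurable fun u : Finset.Icc 1 t → Fin 2 => Ψ (extendRecord u) :=
    measurable_of_finite _
  convert h.comp (measurable_record Y t) using 2 with ω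
  exact hΨ _ _ fun r hr => (extendRecord_restrict (fun r => Y r ω) hr).symm

end SigmaGen

/-! ### One-step errors of the initial draw, the move and the resampling -/

section Steps

variable {Ω S : Type*} [MeasurableSpace Ω] [MeasurableSpace S] {n : ℕ} {P : Measure Ω}
  [IsProbabilityMeasure P] {prior : Measure S} [IsProbabilityMeasure prior]
  {K : ℕ → Kernel S S} [∀ t, IsMarkovKernel (K t)] {g : Fin 2 → S → ℝ} {Y : ℕ → Ω → Fin 2}
  {mutation : Mutation} {x xbar : ℕ → Ω → Fin n → S} {ξ : ℕ → Ω → Fin n → ℕ} {f : S → ℝ} {C : ℝ}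

theorem move_deviation_eq (hn : 1 ≤ n) (κ : Kernel S S) [IsMarkovKernel κ] (mutation : Mutation)
    (hf : Measurable f) (hC : ∀ z, |f z| ≤ C) (w z : Fin n → S) :
    ∫ a, f a ∂(empirical z) - ∫ a, ∫ b, f b ∂(κ a) ∂(empirical w)
      = (∑ i, f (z i)) / n - (∑ i, ∫ a, f a ∂(mutation.law κ w i)) / n := by
  rw [integral_empirical z hf, average_integral_mutation_law hn κ mutation w hf ⟨C, hC⟩]

theorem measurable_move_deviation (κ : Kernel S S) [IsMarkovKernel κ] (hf : Measurable f) :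
    Measurable (Function.uncurry fun w z : Fin n → S =>
      ∫ a, f a ∂(empirical z) - ∫ a, ∫ b, f b ∂(κ a) ∂(empirical w)) := by
  have hκ := measurable_integral_kernel κ hf
  simp only [integral_empirical _ hf, integral_empirical _ hκ]
  refine Measurable.sub (Measurable.div_const (Finset.measurable_sum _ fun i _ => ?_) _)
    (Measurable.div_const (Finset.measurable_sum _ fun i _ => ?_) _)
  · exact hf.comp ((measurable_pi_apply i).comp measurable_snd)
  · exact hκ.comp ((measurable_pi_apply i).comp measurable_fst)

variable (hF : IsBootstrapFilter P prior K g Y mutation x xbar ξ)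

include hF

omit [IsProbabilityMeasure prior] in
theorem IsBootstrapFilter.move_sq_le (hY : ∀ t, Measurable (Y t)) (hn : 1 ≤ n)
    (hf : Measurable f) (hC : ∀ z, |f z| ≤ C) (t : ℕ) :
    Integrable (fun ω => (∫ z, f z ∂(empirical (xbar (t + 1) ω))
        - ∫ z, (∫ z', f z' ∂(K t z)) ∂(empirical (x t ω))) ^ 2) P ∧
      ∫ ω, (∫ z, f z ∂(empirical (xbar (t + 1) ω))
        - ∫ z, (∫ z', f z' ∂(K t z)) ∂(empirical (x t ω))) ^ 2 ∂P ≤ C ^ 2 / n := by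
  have hlaw := isProbabilityMeasure_mutation_law hn (K t) mutation
  refine HasCondLaw.integral_sq_le (κ := moveKernel hn (K t) mutation) (hF.move t)
    (sup_le (sup_le (sigmaGen_le hF.measurable_x _) (sigmaGen_le hF.measurable_xbar _))
      (sigmaGen_le hY _))
    ((measurable_sigmaGen (by simp)).mono (le_sup_left.trans le_sup_left) le_rfl)
    (hF.measurable_xbar (t + 1)) (measurable_move_deviation (K t) hf) fun w => ?_
  simp_rw [move_deviation_eq hn (K t) mutation hf hC]
  exact integral_sq_average_sub_le (mutation.law (K t) w) hf hC

omit [IsProbabilityMeasure prior] in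
theorem IsBootstrapFilter.move_tail_le (hY : ∀ t, Measurable (Y t)) (hn : 1 ≤ n)
    (hf : Measurable f) (hC : ∀ z, |f z| ≤ C) (t : ℕ) {ε : ℝ} (hε : 0 < ε) :
    P.real {ω | ε ≤ |∫ z, f z ∂(empirical (xbar (t + 1) ω))
        - ∫ z, (∫ z', f z' ∂(K t z)) ∂(empirical (x t ω))|}
      ≤ 2 * Real.exp (-(n * (ε ^ 2 / (2 * C ^ 2)))) := by
  have hlaw := isProbabilityMeasure_mutation_law hn (K t) mutation
  refine HasCondLaw.measureReal_ge_le (κ := moveKernel hn (K t) mutation) (hF.move t)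
    (sup_le (sup_le (sigmaGen_le hF.measurable_x _) (sigmaGen_le hF.measurable_xbar _))
      (sigmaGen_le hY _))
    ((measurable_sigmaGen (by simp)).mono (le_sup_left.trans le_sup_left) le_rfl)
    (hF.measurable_xbar (t + 1)) (measurable_move_deviation (K t) hf) fun w => ?_
  simp_rw [move_deviation_eq hn (K t) mutation hf hC]
  exact measureReal_abs_average_sub_ge_le (mutation.law (K t) w) hf hC hε

omit [IsProbabilityMeasure P] [∀ t, IsMarkovKernel (K t)] in
theorem IsBootstrapFilter.init_tail_le (hf : Measurable f) (hC : ∀ z, |f z| ≤ C) (hn : 1 ≤ n)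
    {ε : ℝ} (hε : 0 < ε) :
    P.real {ω | ε ≤ |∫ z, f z ∂(empirical (x 0 ω)) - ∫ z, f z ∂prior|}
      ≤ 2 * Real.exp (-(n * (ε ^ 2 / (2 * C ^ 2)))) := by
  have hn' : (n : ℝ) ≠ 0 := by exact_mod_cast (by omega : n ≠ 0)
  have hs : MeasurableSet {z : Fin n → S |
      ε ≤ |(∑ i, f (z i)) / n - (∑ _i : Fin n, ∫ a, f a ∂prior) / n|} := by
    refine measurableSet_le measurable_const (Measurable.abs (Measurable.sub_const
      (Measurable.div_const (Finset.measurable_sum _ fun i _ => ?_) _) _))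
    exact hf.comp (measurable_pi_apply i)
  have key := measureReal_abs_average_sub_ge_le (fun _ : Fin n => prior) hf hC hε
  rw [← hF.init, map_measureReal_apply (hF.measurable_x 0) hs] at key
  refine le_trans (le_of_eq ?_) key
  congr 1
  ext ω
  simp [integral_empirical _ hf, hn']

omit [IsProbabilityMeasure P] [IsProbabilityMeasure prior]
  [∀ t, IsMarkovKernel (K t)] in
-- The empirical measure of the resampled particles sees only the offspring numbers, so the
-- labelling is irrelevant and the law of `ξ` suffices.
theorem IsBootstrapFilter.resampling_deviation_ae_eq (hg0 : ∀ y z, 0 ≤ g y z)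
    (hf : Measurable f) (t : ℕ) :
    (fun ω => ∫ z, f z ∂(empirical (x (t + 1) ω))
        - ∫ z, f z ∂(weightedEmpirical (weights (g (Y (t + 1) ω)) (xbar (t + 1) ω))
          (xbar (t + 1) ω)))
      =ᵐ[P] fun ω => (∑ j, (ξ (t + 1) ω j : ℝ) * f (xbar (t + 1) ω j)) / n
        - ∑ j, weights (g (Y (t + 1) ω)) (xbar (t + 1) ω) j * f (xbar (t + 1) ω j) := by
  filter_upwards [hF.relabel t] with ω ⟨a, ha, hξ⟩
  rw [integral_empirical _ hf, integral_weightedEmpirical (weights_nonneg (hg0 _) _) _ hf]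
  simp_rw [ha, hξ]
  rw [sum_offspring_mul a fun j => f (xbar (t + 1) ω j)]

omit hF [MeasurableSpace Ω] [IsProbabilityMeasure P] [IsProbabilityMeasure prior] in
theorem measurable_resampling_deviation (hg : ∀ y, Measurable (g y)) (hf : Measurable f) :
    Measurable (Function.uncurry fun (w : Fin 2 × (Fin n → S)) (k : Fin n → ℕ) =>
      (∑ j, (k j : ℝ) * f (w.2 j)) / n - ∑ j, weights (g w.1) w.2 j * f (w.2 j)) := by
  have h1 : ∀ j, Measurable fun p : (Fin 2 × (Fin n → S)) × (Fin n → ℕ) => f (p.1.2 j) := fun j =>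
    hf.comp ((measurable_pi_apply j).comp (measurable_snd.comp measurable_fst))
  have h2 : ∀ j, Measurable fun p : (Fin 2 × (Fin n → S)) × (Fin n → ℕ) => (p.2 j : ℝ) := fun j =>
    (measurable_of_countable _).comp ((measurable_pi_apply j).comp measurable_snd)
  refine Measurable.sub (Measurable.div_const (Finset.measurable_sum _ fun j _ => ?_) _)
    (Finset.measurable_sum _ fun j _ => ?_)
  · exact (h2 j).mul (h1 j)
  · exact ((measurable_weights hg j).comp measurable_fst).mul (h1 j)

omit hF [MeasurableSpace Ω] [IsProbabilityMeasure P] [IsProbabilityMeasure prior]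
  [∀ t, IsMarkovKernel (K t)] in
theorem measurable_outcome_xbar (t : ℕ) :
    Measurable[sigmaGen (Finset.range (t + 1)) x ⊔ sigmaGen (Finset.Icc 1 (t + 1)) xbar
        ⊔ sigmaGen (Finset.Icc 1 (t + 1)) Y] fun ω => (Y (t + 1) ω, xbar (t + 1) ω) :=
  Measurable.prodMk ((measurable_sigmaGen (by simp)).mono le_sup_right le_rfl)
    ((measurable_sigmaGen (by simp)).mono (le_sup_right.trans le_sup_left) le_rfl)

omit [IsProbabilityMeasure prior] [∀ t, IsMarkovKernel (K t)] in
theorem IsBootstrapFilter.resampling_sq_le (hY : ∀ t, Measurable (Y t))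
    (hg : ∀ y, Measurable (g y)) (hg0 : ∀ y z, 0 ≤ g y z) (hn : 1 ≤ n)
    (hf : Measurable f) (hC : ∀ z, |f z| ≤ C) (t : ℕ) :
    Integrable (fun ω => (∫ z, f z ∂(empirical (x (t + 1) ω))
        - ∫ z, f z ∂(weightedEmpirical (weights (g (Y (t + 1) ω)) (xbar (t + 1) ω))
          (xbar (t + 1) ω))) ^ 2) P ∧
      ∫ ω, (∫ z, f z ∂(empirical (x (t + 1) ω))
        - ∫ z, f z ∂(weightedEmpirical (weights (g (Y (t + 1) ω)) (xbar (t + 1) ω))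
          (xbar (t + 1) ω))) ^ 2 ∂P ≤ C ^ 2 / n := by
  have key := HasCondLaw.integral_sq_le (κ := offspringKernel hn hg hg0)
    (W := fun ω => (Y (t + 1) ω, xbar (t + 1) ω)) (hF.offspring t)
    (sup_le (sup_le (sigmaGen_le hF.measurable_x _) (sigmaGen_le hF.measurable_xbar _))
      (sigmaGen_le hY _)) (measurable_outcome_xbar t)
    (hF.measurable_ξ (t + 1)) (measurable_resampling_deviation hg hf) (B := C ^ 2 / n) fun w =>
      integral_sq_multinomial_le hn (weights_nonneg (hg0 w.1) w.2) (sum_weights hn (g w.1) w.2)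
        fun j => hC (w.2 j)
  have hae := (hF.resampling_deviation_ae_eq hg0 hf t).fun_comp (· ^ 2)
  exact ⟨key.1.congr hae.symm, (integral_congr_ae hae).trans_le key.2⟩

omit [IsProbabilityMeasure prior] [∀ t, IsMarkovKernel (K t)] in
theorem IsBootstrapFilter.resampling_tail_le (hY : ∀ t, Measurable (Y t))
    (hg : ∀ y, Measurable (g y)) (hg0 : ∀ y z, 0 ≤ g y z) (hn : 1 ≤ n)
    (hf : Measurable f) (hC : ∀ z, |f z| ≤ C) (t : ℕ) {ε : ℝ} (hε : 0 < ε) :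
    P.real {ω | ε ≤ |∫ z, f z ∂(empirical (x (t + 1) ω))
        - ∫ z, f z ∂(weightedEmpirical (weights (g (Y (t + 1) ω)) (xbar (t + 1) ω))
          (xbar (t + 1) ω))|} ≤ 2 * Real.exp (-(n * (ε ^ 2 / (2 * C ^ 2)))) := by
  have key := HasCondLaw.measureReal_ge_le (κ := offspringKernel hn hg hg0)
    (W := fun ω => (Y (t + 1) ω, xbar (t + 1) ω)) (hF.offspring t)
    (sup_le (sup_le (sigmaGen_le hF.measurable_x _) (sigmaGen_le hF.measurable_xbar _))
      (sigmaGen_le hY _)) (measurable_outcome_xbar t)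
    (hF.measurable_ξ (t + 1)) (measurable_resampling_deviation hg hf) fun w =>
      measureReal_abs_multinomial_ge_le hn (weights_nonneg (hg0 w.1) w.2)
        (sum_weights hn (g w.1) w.2) (fun j => hC (w.2 j)) hε
  refine le_trans (le_of_eq (measureReal_congr ?_)) key
  filter_upwards [hF.resampling_deviation_ae_eq hg0 hf t] with ω hω
  exact congrArg (fun r => ε ≤ |r|) hω

end Steps

/-! ### Convergence of the bootstrap filter -/

section FilterConvergence

variable {Ω S : Type*} [MeasurableSpace Ω] [MeasurableSpace S] {P : Measure Ω}
  [IsProbabilityMeasure P] {prior : Measure S} [IsProbabilityMeasure prior]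
  {K : ℕ → Kernel S S} [∀ t, IsMarkovKernel (K t)] {g : Fin 2 → S → ℝ} {Y : ℕ → Ω → Fin 2}
  {mutation : Mutation} {x xbar : ∀ n : ℕ, ℕ → Ω → Fin n → S} {ξ : ∀ n : ℕ, ℕ → Ω → Fin n → ℕ}

omit [MeasurableSpace S] in
theorem ae_tendsto_zero_of_subgaussian_tail {D : ℕ → Ω → ℝ} {f : S → ℝ} (hf : ∃ C, ∀ z, |f z| ≤ C)
    (h : ∀ C, (∀ z, |f z| ≤ C) → ∀ n, 1 ≤ n → ∀ ε, 0 < ε →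
      P.real {ω | ε ≤ |D n ω|} ≤ 2 * Real.exp (-(n * (ε ^ 2 / (2 * C ^ 2))))) :
    ∀ᵐ ω ∂P, Tendsto (fun n => D n ω) atTop (𝓝 0) := by
  obtain ⟨C, hC⟩ := hf
  -- The bound is enlarged to `|C| + 1` so that the constant in the exponent is strictly positive.
  exact ae_tendsto_zero_of_exp_tail (by positivity : 0 < 2 * (|C| + 1) ^ 2)
    (h (|C| + 1) fun z => (hC z).trans ((le_abs_self C).trans (by simp)))

variable (hY : ∀ t, Measurable (Y t)) (hg : ∀ y, Measurable (g y)) (hg0 : ∀ y z, 0 ≤ g y z)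
  (hgb : ∀ y, ∃ C, ∀ z, |g y z| ≤ C)
  (hF : ∀ n, 1 ≤ n → IsBootstrapFilter P prior K g Y mutation (x n) (xbar n) (ξ n))

omit [IsProbabilityMeasure P] in
include hg hg0 hgb in
-- The function `x ↦ ∫ f d(K t x)` is again bounded and measurable, so the hypothesis applies to it
-- directly.
theorem ConvergesPointwise.bind_kernel {t : ℕ}
    (h : ConvergesPointwise P (fun n ω => empirical (x n t ω))
      (fun ω => posterior prior K g (fun r => Y r ω) t)) :
    ConvergesPointwise P (fun n ω => (empirical (x n t ω)).bind (K t))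
      (fun ω => predictive prior K g (fun r => Y r ω) t) := by
  intro f hf hfb
  filter_upwards [h _ (measurable_integral_kernel (K t) hf)
    (hfb.imp fun C hC z => abs_integral_le_of_bound (K t z) hC)] with ω hω
  have := isZeroOrProbabilityMeasure_posterior (prior := prior) (K := K) hg hg0 hgb
    (fun r => Y r ω) t
  rw [predictive, integral_bind_kernel _ _ hf hfb]
  refine hω.congr' ?_
  filter_upwards [eventually_ge_atTop 1] with n hn
  have := isProbabilityMeasure_empirical hn (x n t ω)
  rw [integral_bind_kernel _ _ hf hfb]

omit [IsProbabilityMeasure prior] in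
include hY hF in
theorem ConvergesPointwise.move {t : ℕ} {ν : Ω → Measure S}
    (h : ConvergesPointwise P (fun n ω => (empirical (x n t ω)).bind (K t)) ν) :
    ConvergesPointwise P (fun n ω => empirical (xbar n (t + 1) ω)) ν := by
  intro f hf hfb
  filter_upwards [h f hf hfb, ae_tendsto_zero_of_subgaussian_tail hfb fun C hC n hn ε hε =>
    (hF n hn).move_tail_le hY hn hf hC t hε] with ω h1 h2
  refine (by simpa using h1.add h2 : Tendsto _ _ _).congr' ?_
  filter_upwards [eventually_ge_atTop 1] with n hn
  have := isProbabilityMeasure_empirical hn (x n t ω)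
  rw [integral_bind_kernel _ _ hf hfb]
  ring

omit [IsProbabilityMeasure prior] [∀ t, IsMarkovKernel (K t)] in
include hY hg hg0 hgb hF in
theorem ConvergesPointwise.resampling {t : ℕ}
    (h : ConvergesPointwise P (fun n ω => empirical (xbar n (t + 1) ω))
      (fun ω => predictive prior K g (fun r => Y r ω) t))
    (hne : ∀ᵐ ω ∂P, ∫ z, g (Y (t + 1) ω) z ∂(predictive prior K g (fun r => Y r ω) t) ≠ 0) :
    ConvergesPointwise P (fun n ω => empirical (x n (t + 1) ω))
      (fun ω => posterior prior K g (fun r => Y r ω) (t + 1)) := by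
  intro f hf hfb
  have hgf : ∀ y, ∃ C, ∀ z, |g y z * f z| ≤ C := fun y => by
    obtain ⟨A, hA⟩ := hgb y
    obtain ⟨B, hB⟩ := hfb
    exact ⟨A * B, fun z => by
      rw [abs_mul]
      exact mul_le_mul (hA z) (hB z) (abs_nonneg _) ((abs_nonneg _).trans (hA z))⟩
  -- The function `g (Y (t + 1) ω)` is random while `h` takes a fixed test function; both outcomes
  -- are handled simultaneously and the observed one is selected afterwards.
  filter_upwards [hne, ae_all_iff.2 fun y => h (g y) (hg y) (hgb y),
    ae_all_iff.2 fun y => h (fun z => g y z * f z) ((hg y).mul hf) (hgf y),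
    ae_tendsto_zero_of_subgaussian_tail hfb fun C hC n hn ε hε =>
      (hF n hn).resampling_tail_le hY hg hg0 hn hf hC t hε] with ω h0 h1 h2 h3
  rw [posterior, ← predictive, integral_bayesUpdate (hg _) (hg0 _)]
  refine (by simpa using ((h2 (Y (t + 1) ω)).div (h1 (Y (t + 1) ω)) h0).add h3 :
    Tendsto _ _ _).congr' ?_
  -- The empirical normalizing constant is eventually nonzero, so the fallback weights no longer
  -- occur.
  filter_upwards [(h1 (Y (t + 1) ω)).eventually_ne h0] with n hn
  rw [integral_weightedEmpirical_weights (hg _) (hg0 _) hf _ hn]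
  ring

include hY hg hg0 hgb hF in
theorem convergesPointwise_empirical
    (hne : ∀ t, ∀ᵐ ω ∂P, ∫ z, g (Y (t + 1) ω) z ∂(predictive prior K g (fun r => Y r ω) t) ≠ 0)
    (t : ℕ) : ConvergesPointwise P (fun n ω => empirical (x n t ω))
      (fun ω => posterior prior K g (fun r => Y r ω) t) := by
  induction t with
  | zero =>
    intro f hf hfb
    filter_upwards [ae_tendsto_zero_of_subgaussian_tail hfb fun C hC n hn ε hε =>
      (hF n hn).init_tail_le hf hC hn hε] with ω h
    simpa [posterior] using h.add_const (∫ z, f z ∂prior)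
  | succ t ih => exact ((ih.bind_kernel hg hg0 hgb).move hY hF).resampling hY hg hg0 hgb hF (hne t)

include hY hg hg0 hgb hF in
theorem bootstrapFilter_converges [TopologicalSpace S] [PolishSpace S] [BorelSpace S]
    (hne : ∀ t, ∀ᵐ ω ∂P, ∫ z, g (Y (t + 1) ω) z ∂(predictive prior K g (fun r => Y r ω) t) ≠ 0)
    (t : ℕ) :
    (ConvergesInExpectation P (fun n ω => empirical (x n t ω))
        (fun ω => posterior prior K g (fun r => Y r ω) t) ∧
      ConvergesAlmostSurely P (fun n ω => empirical (x n t ω))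
        (fun ω => posterior prior K g (fun r => Y r ω) t)) ∧
    (ConvergesInExpectation P (fun n ω => empirical (xbar n (t + 1) ω))
        (fun ω => predictive prior K g (fun r => Y r ω) t) ∧
      ConvergesAlmostSurely P (fun n ω => empirical (xbar n (t + 1) ω))
        (fun ω => predictive prior K g (fun r => Y r ω) t)) ∧
    (ConvergesInExpectation P (fun n ω => (empirical (x n t ω)).bind (K t))
        (fun ω => predictive prior K g (fun r => Y r ω) t) ∧
      ConvergesAlmostSurely P (fun n ω => (empirical (x n t ω)).bind (K t))
        (fun ω => predictive prior K g (fun r => Y r ω) t)) := by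
  have c1 := convergesPointwise_empirical hY hg hg0 hgb hF hne t
  have c2 := c1.bind_kernel hg hg0 hgb
  have c3 := c2.move hY hF
  have p1 : ∀ᵐ ω ∂P, IsProbabilityMeasure (posterior prior K g (fun r => Y r ω) t) := by
    filter_upwards [ae_all_iff.2 hne] with ω hω
    exact isProbabilityMeasure_posterior hg hg0 hgb hω t
  have p2 : ∀ᵐ ω ∂P, IsProbabilityMeasure (predictive prior K g (fun r => Y r ω) t) := by
    filter_upwards [p1] with ω hω
    rw [predictive]
    infer_instance
  have e1 := fun n (hn : 1 ≤ n) ω => isProbabilityMeasure_empirical hn (x n t ω)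
  have e2 : ∀ n, 1 ≤ n → ∀ ω, IsProbabilityMeasure ((empirical (x n t ω)).bind (K t)) :=
    fun n hn ω => by have := e1 n hn ω; infer_instance
  have e3 := fun n (hn : 1 ≤ n) ω => isProbabilityMeasure_empirical hn (xbar n (t + 1) ω)
  have m1 : ∀ f : S → ℝ, Measurable f →
      Measurable fun ω => ∫ z, f z ∂(posterior prior K g (fun r => Y r ω) t) := fun f _ =>
    (measurable_record_functional (Ψ := fun y => ∫ z, f z ∂(posterior prior K g y t))
      fun y y' h => by rw [posterior_congr h]).mono (sigmaGen_le hY _) le_rfl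
  have m2 : ∀ f : S → ℝ, Measurable f →
      Measurable fun ω => ∫ z, f z ∂(predictive prior K g (fun r => Y r ω) t) := fun f _ =>
    (measurable_record_functional (Ψ := fun y => ∫ z, f z ∂(predictive prior K g y t))
      fun y y' h => by rw [predictive, predictive, posterior_congr h]).mono
      (sigmaGen_le hY _) le_rfl
  have me : ∀ (n : ℕ) (f : S → ℝ), Measurable f →
      Measurable fun u : Fin n → S => ∫ z, f z ∂(empirical u) := fun n f hf => by
    simp only [integral_empirical _ hf]
    exact Measurable.div_const (Finset.measurable_sum _ fun i _ =>
      hf.comp (measurable_pi_apply i)) _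
  have mb : ∀ (n : ℕ) (f : S → ℝ), Measurable f →
      Measurable fun u : Fin n → S => ∫ z, f z ∂((empirical u).bind (K t)) := fun n f hf => by
    have hm := (Measure.measurable_bind' (K t).measurable).comp (measurable_empirical (S := S)
      (n := n))
    exact (hf.stronglyMeasurable.integral_kernel (κ := ⟨_, hm⟩)).measurable
  exact ⟨⟨c1.convergesInExpectation e1 p1
        (fun f hf n hn => (me n f hf).comp ((hF n hn).measurable_x t)) m1,
      c1.convergesAlmostSurely e1 p1⟩,
    ⟨c3.convergesInExpectation e3 p2
        (fun f hf n hn => (me n f hf).comp ((hF n hn).measurable_xbar (t + 1))) m2,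
      c3.convergesAlmostSurely e3 p2⟩,
    ⟨c2.convergesInExpectation e2 p2
        (fun f hf n hn => (mb n f hf).comp ((hF n hn).measurable_x t)) m2,
      c2.convergesAlmostSurely e2 p2⟩⟩

end FilterConvergence

/-! ### The recursion computes the conditional law -/

section ConditionalLaw

variable {Ω S : Type*} [MeasurableSpace Ω] [MeasurableSpace S] {P : Measure Ω}
  [IsProbabilityMeasure P]

/-- The hypothesis says that `X` has law `P A • μ` under `P.restrict A`, so indicators extend to
general integrands. -/
theorem setIntegral_comp_of_measureReal_inter {A : Set Ω} {X : Ω → S} (hX : Measurable X)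
    {μ : Measure S} [IsFiniteMeasure μ]
    (h : ∀ B, MeasurableSet B → P.real (A ∩ X ⁻¹' B) = P.real A * μ.real B) {φ : S → ℝ}
    (hφ : Measurable φ) : ∫ ω in A, φ (X ω) ∂P = P.real A * ∫ z, φ z ∂μ := by
  have hmap : (P.restrict A).map X = P A • μ := by
    ext B hB
    rw [Measure.map_apply hX hB, Measure.restrict_apply (hX hB), Set.inter_comm,
      Measure.smul_apply, smul_eq_mul, ← ENNReal.toReal_eq_toReal_iff' (measure_ne_top _ _)
        (ENNReal.mul_ne_top (measure_ne_top _ _) (measure_ne_top _ _)), ENNReal.toReal_mul]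
    exact h B hB
  rw [← integral_map (f := φ) hX.aemeasurable hφ.aestronglyMeasurable, hmap, integral_smul_measure,
    smul_eq_mul, measureReal_def]

theorem measureReal_bind_kernel {E : Type*} [MeasurableSpace E] (p : Measure S) [IsFiniteMeasure p]
    (κ : Kernel S E) [IsMarkovKernel κ] {B : Set E} (hB : MeasurableSet B) :
    (p.bind κ).real B = ∫ x, (κ x).real B ∂p := by
  rw [← integral_indicator_one hB, integral_bind_kernel p κ (measurable_one.indicator hB)
    ⟨1, fun x => by simp only [Set.indicator]; split_ifs <;> simp⟩]
  simp_rw [integral_indicator_one hB]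

theorem measureReal_bayesUpdate {g : S → ℝ} (hg : Measurable g) (hg0 : ∀ x, 0 ≤ g x)
    (p : Measure S) {B : Set S} (hB : MeasurableSet B) :
    (bayesUpdate g p).real B = (∫ x in B, g x ∂p) / ∫ x, g x ∂p := by
  rw [← integral_indicator_one hB, integral_bayesUpdate hg hg0, ← integral_indicator hB]
  congr 2
  ext x
  by_cases hx : x ∈ B <;> simp [hx]

/-- The event that the outcomes at the times `1, …, t` are those of the record `y`. -/
def recordEvent (Y : ℕ → Ω → Fin 2) (y : ℕ → Fin 2) (t : ℕ) : Set Ω :=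
  {ω | ∀ r ∈ Finset.Icc 1 t, Y r ω = y r}

variable {prior : Measure S} [IsProbabilityMeasure prior] {K : ℕ → Kernel S S}
  [∀ t, IsMarkovKernel (K t)] {g : Fin 2 → S → ℝ} {X : ℕ → Ω → S} {Y : ℕ → Ω → Fin 2}

omit [MeasurableSpace Ω] in
theorem measurableSet_recordEvent (Y : ℕ → Ω → Fin 2) (y : ℕ → Fin 2) (t : ℕ) :
    MeasurableSet[sigmaGen (Finset.Icc 1 t) Y] (recordEvent Y y t) := by
  have : recordEvent Y y t = ⋂ r ∈ Finset.Icc 1 t, Y r ⁻¹' {y r} := by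
    ext ω
    simp [recordEvent]
  rw [this]
  exact Finset.measurableSet_biInter _ fun r hr =>
    measurable_sigmaGen hr (measurableSet_singleton _)

omit [MeasurableSpace Ω] in
theorem recordEvent_succ (Y : ℕ → Ω → Fin 2) (y : ℕ → Fin 2) (t : ℕ) :
    recordEvent Y y (t + 1) = recordEvent Y y t ∩ Y (t + 1) ⁻¹' {y (t + 1)} := by
  ext ω
  simp only [recordEvent, Set.mem_ofPred_eq, Set.mem_inter_iff, Set.mem_preimage,
    Set.mem_singleton_iff]
  constructor
  · exact fun h => ⟨fun r hr => h r (Finset.Icc_subset_Icc le_rfl t.le_succ hr), h _ (by simp)⟩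
  · rintro ⟨h1, h2⟩ r hr
    rcases (Finset.mem_Icc.1 hr).2.eq_or_lt with rfl | hlt
    · exact h2
    · exact h1 r (Finset.mem_Icc.2 ⟨(Finset.mem_Icc.1 hr).1, by omega⟩)

variable (hM : IsStateSpaceModel P prior K g X Y) (hg : ∀ y, Measurable (g y))
  (hg0 : ∀ y z, 0 ≤ g y z) (hgb : ∀ y, ∃ C, ∀ z, |g y z| ≤ C) (hg1 : ∀ z, ∑ y, g y z = 1)

omit [IsProbabilityMeasure prior] in
include hM in
theorem IsStateSpaceModel.measureReal_inter_predictive {y : ℕ → Fin 2} {t : ℕ}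
    [IsFiniteMeasure (posterior prior K g y t)]
    (h : ∀ B, MeasurableSet B → P.real (recordEvent Y y t ∩ X t ⁻¹' B)
      = P.real (recordEvent Y y t) * (posterior prior K g y t).real B) {B : Set S}
    (hB : MeasurableSet B) :
    P.real (recordEvent Y y t ∩ X (t + 1) ⁻¹' B)
      = P.real (recordEvent Y y t) * (predictive prior K g y t).real B := by
  rw [(hM.transition t).measureReal_inter
    (sup_le (sigmaGen_le hM.measurable_X _) (sigmaGen_le hM.measurable_Y _))
    (hM.measurable_X (t + 1)) ((le_sup_right : _ ≤ _ ⊔ sigmaGen (Finset.Icc 1 t) Y) _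
      (measurableSet_recordEvent Y y t)) hB,
    setIntegral_comp_of_measureReal_inter (φ := fun z => (K t z).real B) (hM.measurable_X t) h
      ((K t).measurable_coe hB).ennreal_toReal, predictive, measureReal_bind_kernel _ _ hB]

omit [IsProbabilityMeasure prior] [∀ t, IsMarkovKernel (K t)] in
include hM hg hg1 in
-- The event up to the new state is measurable for the history on which the outcome is conditioned,
-- so the new outcome contributes the factor `g (y (t + 1)) (X (t + 1))`, integrated against the
-- predictive measure.
theorem IsStateSpaceModel.measureReal_inter_outcome {y : ℕ → Fin 2} {t : ℕ}
    [IsFiniteMeasure (predictive prior K g y t)]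
    (h : ∀ B, MeasurableSet B → P.real (recordEvent Y y t ∩ X (t + 1) ⁻¹' B)
      = P.real (recordEvent Y y t) * (predictive prior K g y t).real B) {B : Set S}
    (hB : MeasurableSet B) :
    P.real (recordEvent Y y (t + 1) ∩ X (t + 1) ⁻¹' B)
      = P.real (recordEvent Y y t) * ∫ z in B, g (y (t + 1)) z ∂(predictive prior K g y t) := by
  have hm := sup_le (sigmaGen_le hM.measurable_X (Finset.range (t + 2)))
    (sigmaGen_le hM.measurable_Y (Finset.Icc 1 t))
  have hE : MeasurableSet[sigmaGen (Finset.range (t + 2)) X ⊔ sigmaGen (Finset.Icc 1 t) Y]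
      (recordEvent Y y t ∩ X (t + 1) ⁻¹' B) :=
    MeasurableSet.inter ((le_sup_right : _ ≤ _ ⊔ sigmaGen (Finset.Icc 1 t) Y) _
        (measurableSet_recordEvent Y y t))
      ((le_sup_left : _ ≤ sigmaGen (Finset.range (t + 2)) X ⊔ _) _
        (measurable_sigmaGen (by simp) hB))
  have hYm : MeasurableSet (Y (t + 1) ⁻¹' {y (t + 1)}) :=
    hM.measurable_Y (t + 1) (measurableSet_singleton _)
  have h1 : P.real (recordEvent Y y (t + 1) ∩ X (t + 1) ⁻¹' B)
      = ∫ ω in recordEvent Y y t ∩ X (t + 1) ⁻¹' B, g (y (t + 1)) (X (t + 1) ω) ∂P := by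
    have h2 := setIntegral_condExp hm
      ((integrable_const (1 : ℝ)).indicator hYm : Integrable _ P) hE
    rw [setIntegral_congr_ae (hm _ hE) ((hM.observation t (y (t + 1))).mono fun ω hω _ => hω),
      setIntegral_indicator hYm] at h2
    simp only [hg1, div_one] at h2
    rw [h2, recordEvent_succ, Set.inter_right_comm]
    simp
  rw [h1, ← setIntegral_indicator (hM.measurable_X (t + 1) hB), ← integral_indicator hB]
  exact setIntegral_comp_of_measureReal_inter (φ := B.indicator (g (y (t + 1))))
    (hM.measurable_X (t + 1)) h ((hg _).indicator hB)

include hM hg hg0 hgb hg1 in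
-- Bayes' rule. Taking `B = univ` in the outcome step gives `P(record to t + 1) = P(record to t) · ∫
-- g dp`, and dividing by this normalizing constant is exactly the update.
theorem IsStateSpaceModel.measureReal_inter_posterior (y : ℕ → Fin 2) (t : ℕ) :
    ∀ B, MeasurableSet B → P.real (recordEvent Y y t ∩ X t ⁻¹' B)
      = P.real (recordEvent Y y t) * (posterior prior K g y t).real B := by
  induction t with
  | zero =>
    intro B hB
    have : recordEvent Y y 0 = Set.univ := by simp [recordEvent]
    rw [this, Set.univ_inter, ← map_measureReal_apply (hM.measurable_X 0) hB, hM.init, posterior]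
    simp
  | succ t ih =>
    intro B hB
    have := isZeroOrProbabilityMeasure_posterior (prior := prior) (K := K) hg hg0 hgb y t
    have : IsFiniteMeasure (predictive prior K g y t) := by rw [predictive]; infer_instance
    have key := fun {B} => hM.measureReal_inter_outcome (B := B) hg hg1
      fun B hB => hM.measureReal_inter_predictive ih hB
    have huniv := key MeasurableSet.univ
    rw [Set.preimage_univ, Set.inter_univ, Measure.restrict_univ] at huniv
    rw [key hB, huniv, posterior, measureReal_bayesUpdate (hg _) (hg0 _) _ hB, ← predictive]
    -- If the constant is zero, so is the integral over `B` by nonnegativity, and both sides vanish.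
    by_cases h0 : ∫ z, g (y (t + 1)) z ∂(predictive prior K g y t) = 0
    · have hle : ∫ z in B, g (y (t + 1)) z ∂(predictive prior K g y t) ≤ 0 :=
        (setIntegral_le_integral (integrable_of_measurable_of_bound (hg _) (hgb _) _)
          (ae_of_all _ (hg0 _))).trans_eq h0
      rw [h0, le_antisymm hle (integral_nonneg (hg0 _))]
      simp
    · field_simp

include hM hg hg0 hgb hg1 in
-- Every event of the outcome σ-algebra is a finite disjoint union of record events, so the defining
-- identity of the conditional expectation need only be checked on those, where the posterior is
-- constant.
theorem IsStateSpaceModel.hasCondLaw_posterior (t : ℕ) :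
    HasCondLaw P (sigmaGen (Finset.Icc 1 t) Y) (X t)
      (fun ω => posterior prior K g (fun r => Y r ω) t) := by
  intro B hB
  have hm := sigmaGen_le hM.measurable_Y (Finset.Icc 1 t)
  have hXB : MeasurableSet (X t ⁻¹' B) := hM.measurable_X t hB
  have hpost : Measurable[sigmaGen (Finset.Icc 1 t) Y]
      fun ω => (posterior prior K g (fun r => Y r ω) t).real B :=
    measurable_record_functional (Ψ := fun y => (posterior prior K g y t).real B)
      fun y y' h => by rw [posterior_congr h]
  have hint1 : Integrable ((X t ⁻¹' B).indicator fun _ => (1 : ℝ)) P :=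
    (integrable_const _).indicator hXB
  have hint2 : Integrable (fun ω => (posterior prior K g (fun r => Y r ω) t).real B) P := by
    refine Integrable.of_bound (hpost.mono hm le_rfl).aestronglyMeasurable 1
      (ae_of_all _ fun ω => ?_)
    have := isZeroOrProbabilityMeasure_posterior (prior := prior) (K := K) hg hg0 hgb
      (fun r => Y r ω) t
    rw [Real.norm_of_nonneg measureReal_nonneg]
    exact measureReal_le_one
  refine (ae_eq_condExp_of_forall_setIntegral_eq hm hint1 (fun _ _ _ => hint2.integrableOn)
    (fun s hs _ => ?_) hpost.aestronglyMeasurable).symm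
  set R : Ω → Finset.Icc 1 t → Fin 2 := fun ω r => Y r ω with hR
  have hRm : Measurable R := (measurable_record Y t).mono hm le_rfl
  -- Every event determined by the outcomes is the preimage of a set `T` of records under `R`.
  have hle : sigmaGen (Finset.Icc 1 t) Y ≤ MeasurableSpace.comap R inferInstance :=
    iSup₂_le fun r hr => Measurable.comap_le (f := Y r)
      ((measurable_pi_apply (⟨r, hr⟩ : Finset.Icc 1 t)).comp (comap_measurable R))
  obtain ⟨T, -, rfl⟩ := hle s hs
  have hT : R ⁻¹' T = ⋃ u ∈ T.toFinite.toFinset, R ⁻¹' {u} := by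
    ext ω
    simp
  have hdisj : Set.PairwiseDisjoint (↑T.toFinite.toFinset) fun u => R ⁻¹' {u} :=
    fun u _ v _ huv => Disjoint.preimage R (Set.disjoint_singleton.2 huv)
  have hRu : ∀ u, R ⁻¹' {u} = recordEvent Y (extendRecord u) t := fun u => by
    ext ω
    simp only [Set.mem_preimage, Set.mem_singleton_iff, recordEvent, Set.mem_ofPred_eq, hR]
    constructor
    · rintro rfl r hr
      exact (extendRecord_restrict (fun r => Y r ω) hr).symm
    · intro h
      ext r
      rw [h r r.2, extendRecord, dif_pos r.2]
  rw [hT, integral_biUnion_finset _ (fun u _ => hRm (measurableSet_singleton u)) hdisj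
      fun _ _ => hint2.integrableOn,
    integral_biUnion_finset _ (fun u _ => hRm (measurableSet_singleton u)) hdisj
      fun _ _ => hint1.integrableOn]
  refine Finset.sum_congr rfl fun u _ => ?_
  have hmeas := hRm (measurableSet_singleton u)
  rw [setIntegral_indicator hXB, hRu] at *
  rw [setIntegral_congr_fun (g := fun _ => (posterior prior K g (extendRecord u) t).real B) hmeas
    fun ω hω => by simp only [posterior_congr hω]]
  simp only [setIntegral_const, smul_eq_mul, mul_one]
  rw [hM.measureReal_inter_posterior hg hg0 hgb hg1 _ t B hB]

include hM hg hg0 hgb hg1 in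
-- The probability of a record up to `t + 1` contains the normalizing constant as a factor, so
-- records where it vanishes are null, and there are finitely many of them.
theorem IsStateSpaceModel.ae_integral_predictive_ne_zero (t : ℕ) :
    ∀ᵐ ω ∂P, ∫ z, g (Y (t + 1) ω) z ∂(predictive prior K g (fun r => Y r ω) t) ≠ 0 := by
  have key : ∀ u : Finset.Icc 1 (t + 1) → Fin 2, ∀ᵐ ω ∂P, ω ∈ recordEvent Y (extendRecord u) (t + 1) →
      ∫ z, g (extendRecord u (t + 1)) z ∂(predictive prior K g (extendRecord u) t) ≠ 0 := fun u => by
    have := isZeroOrProbabilityMeasure_posterior (prior := prior) (K := K) hg hg0 hgb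
      (extendRecord u) t
    have : IsFiniteMeasure (predictive prior K g (extendRecord u) t) := by
      rw [predictive]; infer_instance
    have huniv := hM.measureReal_inter_outcome hg hg1 (fun B hB => hM.measureReal_inter_predictive
      (hM.measureReal_inter_posterior hg hg0 hgb hg1 (extendRecord u) t) hB) MeasurableSet.univ
    rw [Set.preimage_univ, Set.inter_univ, Measure.restrict_univ] at huniv
    by_cases h0 : ∫ z, g (extendRecord u (t + 1)) z ∂(predictive prior K g (extendRecord u) t) = 0
    · rw [h0, mul_zero, measureReal_eq_zero_iff] at huniv
      filter_upwards [measure_eq_zero_iff_ae_notMem.1 huniv] with ω hω h using absurd h hω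
    · exact ae_of_all _ fun _ _ => h0
  filter_upwards [ae_all_iff.2 key] with ω hω
  have h : ∀ r ∈ Finset.Icc 1 (t + 1),
      Y r ω = extendRecord (fun r : Finset.Icc 1 (t + 1) => Y r ω) r := fun r hr =>
    (extendRecord_restrict (fun r => Y r ω) hr).symm
  have h1 := hω _ h
  rwa [← h (t + 1) (by simp), predictive, ← posterior_congr
    fun r hr => h r (Finset.Icc_subset_Icc le_rfl t.le_succ hr)] at h1

end ConditionalLaw

/-! ### The scalar `ρ₀` -/

theorem erf_neg (z : ℝ) : erf (-z) = -erf z := by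
  have h := intervalIntegral.integral_comp_neg (a := 0) (b := z) fun u => Real.exp (-u ^ 2)
  simp only [neg_sq, neg_zero] at h
  rw [erf, erf, h, intervalIntegral.integral_symm, mul_neg]

theorem rho0_neg (b V : ℝ) : rho0 (-b) V = -rho0 b V := by
  simp only [rho0, mul_neg, neg_div, erf_neg, neg_sq, div_neg]
  ring

theorem continuous_exp_neg_sq : Continuous fun u : ℝ => Real.exp (-u ^ 2) := by fun_prop

/-- Comparison with the half-line Gaussian integral `√π / 2`. -/
theorem erf_le_one {z : ℝ} (hz : 0 ≤ z) : erf z ≤ 1 := by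
  have hg := integral_gaussian_Ioi 1
  have hint := (integrable_exp_neg_mul_sq one_pos).integrableOn (s := Set.Ioi (0 : ℝ))
  simp only [neg_mul, one_mul, div_one] at hg hint
  have hle : ∫ u in (0 : ℝ)..z, Real.exp (-u ^ 2) ≤ √Real.pi / 2 := by
    rw [← hg, intervalIntegral.integral_of_le hz]
    exact setIntegral_mono_set hint (ae_of_all _ fun _ => Real.exp_nonneg _)
      (Set.Ioc_subset_Ioi_self.eventuallyLE)
  have hpi : 0 < √Real.pi := Real.sqrt_pos.2 Real.pi_pos
  rw [erf, div_mul_eq_mul_div, div_le_one hpi]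
  linarith

/-- The last two terms of `ρ₀` come from the antiderivative `-exp(-u²)/2` of `u exp(-u²)`. In this
form the sign is visible: the weight `1 - u/a` is positive on `(0, a)`. -/
theorem rho0_eq_integral {b V : ℝ} (hb : b ≠ 0) (hV : 0 < V) :
    rho0 b V = 2 / √Real.pi * ∫ u in (0 : ℝ)..(2 * b / √(2 * V)),
      (1 - u / (2 * b / √(2 * V))) * Real.exp (-u ^ 2) := by
  have hV' : 0 < √(2 * V) := Real.sqrt_pos.2 (by positivity)
  have ha : 2 * b / √(2 * V) ≠ 0 := by positivity
  have hc : √(2 * V) / (2 * b) = (2 * b / √(2 * V))⁻¹ := by rw [inv_div]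
  have hc' : 1 / (2 * b) * (√(2 * V) / √Real.pi) = (2 * b / √(2 * V))⁻¹ / √Real.pi := by
    rw [inv_div]
    ring
  rw [rho0, hc', hc]
  set a : ℝ := 2 * b / √(2 * V)
  have hder : ∀ u ∈ Set.uIcc 0 a, HasDerivAt (fun u : ℝ => -Real.exp (-u ^ 2) / 2)
      (u * Real.exp (-u ^ 2)) u := fun u _ => by
    have := (((hasDerivAt_pow 2 u).fun_neg.exp).fun_neg).div_const 2
    exact this.congr_deriv (by push_cast; ring)
  have hcont : Continuous fun u : ℝ => u * Real.exp (-u ^ 2) := by fun_prop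
  have h1 := intervalIntegral.integral_eq_sub_of_hasDerivAt hder (hcont.intervalIntegrable 0 a)
  have h2 : ∫ u in (0 : ℝ)..a, (1 - u / a) * Real.exp (-u ^ 2)
      = (∫ u in (0 : ℝ)..a, Real.exp (-u ^ 2)) - a⁻¹ * ∫ u in (0 : ℝ)..a, u * Real.exp (-u ^ 2) := by
    rw [← intervalIntegral.integral_const_mul, ← intervalIntegral.integral_sub
      (continuous_exp_neg_sq.intervalIntegrable 0 a) ((hcont.const_mul _).intervalIntegrable 0 a)]
    congr 1
    ext u
    ring
  rw [h2, h1, erf]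
  simp only [ne_eq, OfNat.ofNat_ne_zero, not_false_eq_true, zero_pow, neg_zero, Real.exp_zero]
  ring

theorem rho0_pos {b V : ℝ} (hb : 0 < b) (hV : 0 < V) : 0 < rho0 b V := by
  have hV' : 0 < √(2 * V) := Real.sqrt_pos.2 (by positivity)
  have ha : 0 < 2 * b / √(2 * V) := by positivity
  rw [rho0_eq_integral hb.ne' hV]
  refine mul_pos (div_pos two_pos (Real.sqrt_pos.2 Real.pi_pos))
    (intervalIntegral.intervalIntegral_pos_of_pos_on (Continuous.intervalIntegrable (by fun_prop) _ _)
      (fun u hu => mul_pos ?_ (Real.exp_pos _)) ha)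
  rw [sub_pos, div_lt_one ha]
  exact hu.2

theorem rho0_le_one {b V : ℝ} (hb : 0 < b) (hV : 0 < V) : rho0 b V ≤ 1 := by
  have hV' : 0 < √(2 * V) := Real.sqrt_pos.2 (by positivity)
  have h1 := erf_le_one (z := 2 * b / √(2 * V)) (by positivity)
  -- The two correction terms differ only by the factor `exp(-a²) ≤ 1`.
  have h2 : √(2 * V) / (2 * b) * (Real.exp (-(2 * b / √(2 * V)) ^ 2) / √Real.pi)
      ≤ 1 / (2 * b) * (√(2 * V) / √Real.pi) := by
    calc _ ≤ √(2 * V) / (2 * b) * (1 / √Real.pi) := by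
          gcongr
          exact Real.exp_le_one_iff.2 (neg_nonpos.2 (sq_nonneg _))
      _ = _ := by ring
  rw [rho0]
  linarith

theorem rho0_ne_zero {b V : ℝ} (hb : b ≠ 0) (hV : 0 < V) : rho0 b V ≠ 0 := by
  rcases hb.lt_or_gt with h | h
  · have := rho0_pos (neg_pos.2 h) hV
    rw [rho0_neg] at this
    linarith
  · exact (rho0_pos h hV).ne'

theorem abs_rho0_le_one {b V : ℝ} (hb : b ≠ 0) (hV : 0 < V) : |rho0 b V| ≤ 1 := by
  rcases hb.lt_or_gt with h | h
  · rw [← abs_neg, ← rho0_neg, abs_of_pos (rho0_pos (neg_pos.2 h) hV)]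
    exact rho0_le_one (neg_pos.2 h) hV
  · rw [abs_of_pos (rho0_pos h hV)]
    exact rho0_le_one h hV

/-! ### The normalized likelihood -/

section Likelihood

/-- The likelihood divided by `ρ₀`: the probability `1 / 2 ± s(x)` of the outcome `y`. -/
noncomputable def bornProbability {S : Type*} (s : S → ℝ) (y : Fin 2) (x : S) : ℝ :=
  1 / 2 + s x * ((if y = 1 then 1 else 0) - (if y = 0 then 1 else 0))

variable {S : Type*} {s : S → ℝ}

theorem likelihood_eq_mul (b V : ℝ) (s : S → ℝ) :
    likelihood b V s = fun y x => rho0 b V * bornProbability s y x := by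
  ext y x
  rw [likelihood, bornProbability]
  ring

theorem bornProbability_zero (s : S → ℝ) (x : S) : bornProbability s 0 x = 1 / 2 - s x := by
  simp [bornProbability, sub_eq_add_neg]

theorem bornProbability_one (s : S → ℝ) (x : S) : bornProbability s 1 x = 1 / 2 + s x := by
  simp [bornProbability]

theorem sum_bornProbability (s : S → ℝ) (x : S) : ∑ y, bornProbability s y x = 1 := by
  rw [Fin.sum_univ_two, bornProbability_zero, bornProbability_one]
  ring

theorem bornProbability_nonneg (hs : ∀ x, |s x| ≤ 1 / 2) (y : Fin 2) (x : S) :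
    0 ≤ bornProbability s y x := by
  obtain ⟨h1, h2⟩ := abs_le.1 (hs x)
  fin_cases y
  · exact (bornProbability_zero s x).symm ▸ (by linarith)
  · exact (bornProbability_one s x).symm ▸ (by linarith)

theorem continuous_bornProbability [TopologicalSpace S] (hs : Continuous s) (y : Fin 2) :
    Continuous (bornProbability s y) :=
  continuous_const.add (hs.mul continuous_const)

theorem bornProbability_bounded (hs : ∃ C, ∀ x, |s x| ≤ C) (y : Fin 2) :
    ∃ C, ∀ x, |bornProbability s y x| ≤ C := by
  obtain ⟨C, hC⟩ := hs
  refine ⟨1 / 2 + C, fun x => ?_⟩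
  obtain ⟨h1, h2⟩ := abs_le.1 (hC x)
  fin_cases y
  · exact (bornProbability_zero s x).symm ▸ abs_le.2 ⟨by linarith, by linarith⟩
  · exact (bornProbability_one s x).symm ▸ abs_le.2 ⟨by linarith, by linarith⟩

variable {Ω : Type*} [MeasurableSpace Ω] [MeasurableSpace S] {P : Measure Ω} {prior : Measure S}
  {K : ℕ → Kernel S S} {g : Fin 2 → S → ℝ} {Y : ℕ → Ω → Fin 2} {c : ℝ}

theorem IsStateSpaceModel.of_const_mul (hc : c ≠ 0) {X : ℕ → Ω → S}
    (h : IsStateSpaceModel P prior K (fun y x => c * g y x) X Y) :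
    IsStateSpaceModel P prior K g X Y :=
  { h with
    observation := fun t y => by
      simpa only [← Finset.mul_sum, mul_div_mul_left _ _ hc] using h.observation t y }

theorem IsBootstrapFilter.of_const_mul (hc : c ≠ 0) {n : ℕ} {mutation : Mutation}
    {x xbar : ℕ → Ω → Fin n → S} {ξ : ℕ → Ω → Fin n → ℕ}
    (h : IsBootstrapFilter P prior K (fun y x => c * g y x) Y mutation x xbar ξ) :
    IsBootstrapFilter P prior K g Y mutation x xbar ξ :=
  { h with
    offspring := fun t => by simpa only [weights_const_mul hc] using h.offspring t }

end Likelihood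

end BornFilter

theorem mainTheorem1 {S : Type*} [TopologicalSpace S] [PolishSpace S] [MeasurableSpace S]
    [BorelSpace S] (b V : ℝ) (hb : b ≠ 0) (hV : 0 < V)
    (s : S → ℝ) (hs : Continuous s) (hsb : ∃ C, ∀ x, |s x| ≤ C) :
    -- the scalar is bounded, and the likelihood is bounded and continuous for each outcome
    |BornFilter.rho0 b V| ≤ 1 ∧
    (∀ y, Continuous (BornFilter.likelihood b V s y) ∧
      ∃ C, ∀ x, |BornFilter.likelihood b V s y x| ≤ C) ∧
    ((∀ x, |s x| ≤ 1 / 2) →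
      ∀ (prior : Measure S) [IsProbabilityMeasure prior]
        (K : ℕ → Kernel S S) [∀ t, IsMarkovKernel (K t)], (∀ t, BornFilter.IsFeller (K t)) →
      ∀ {Ω : Type*} [MeasurableSpace Ω] (P : Measure Ω) [IsProbabilityMeasure P]
        (Y : ℕ → Ω → Fin 2), (∀ t, Measurable (Y t)) →
      -- in the state-space model, the recursion gives the conditional law of the state given the
      -- outcomes, and its normalizing constants do not vanish
      (∀ X : ℕ → Ω → S,
        BornFilter.IsStateSpaceModel P prior K (BornFilter.likelihood b V s) X Y →
        ∀ t,
          BornFilter.HasCondLaw P (BornFilter.sigmaGen (Finset.Icc 1 t) Y) (X t)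
            (fun ω => BornFilter.posterior prior K (BornFilter.likelihood b V s)
              (fun r => Y r ω) t) ∧
          ∀ᵐ ω ∂P, ∫ z, BornFilter.likelihood b V s (Y (t + 1) ω) z
            ∂(BornFilter.predictive prior K (BornFilter.likelihood b V s)
              (fun r => Y r ω) t) ≠ 0) ∧
      -- the bootstrap filter, run with `n` particles for every `n ≥ 1`
      (∀ (mutation : BornFilter.Mutation) (x xbar : ∀ n : ℕ, ℕ → Ω → Fin n → S)
        (ξ : ∀ n : ℕ, ℕ → Ω → Fin n → ℕ),
        (∀ n, 1 ≤ n → BornFilter.IsBootstrapFilter P prior K (BornFilter.likelihood b V s) Y mutation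
          (x n) (xbar n) (ξ n)) →
        -- mean-square bounds
        (∀ t n, 1 ≤ n → ∀ f : S → ℝ, Measurable f → ∀ C : ℝ, (∀ z, |f z| ≤ C) →
          (Integrable (fun ω => (∫ z, f z ∂(BornFilter.empirical (xbar n (t + 1) ω))
              - ∫ z, (∫ z', f z' ∂(K t z)) ∂(BornFilter.empirical (x n t ω))) ^ 2) P ∧
            ∫ ω, (∫ z, f z ∂(BornFilter.empirical (xbar n (t + 1) ω))
              - ∫ z, (∫ z', f z' ∂(K t z)) ∂(BornFilter.empirical (x n t ω))) ^ 2 ∂P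
              ≤ C ^ 2 / n) ∧
          (Integrable (fun ω => (∫ z, f z ∂(BornFilter.empirical (x n (t + 1) ω))
              - ∫ z, f z ∂(BornFilter.weightedEmpirical
                  (BornFilter.weights (BornFilter.likelihood b V s (Y (t + 1) ω))
                    (xbar n (t + 1) ω)) (xbar n (t + 1) ω))) ^ 2) P ∧
            ∫ ω, (∫ z, f z ∂(BornFilter.empirical (x n (t + 1) ω))
              - ∫ z, f z ∂(BornFilter.weightedEmpirical
                  (BornFilter.weights (BornFilter.likelihood b V s (Y (t + 1) ω))
                    (xbar n (t + 1) ω)) (xbar n (t + 1) ω))) ^ 2 ∂P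
              ≤ C ^ 2 / n)) ∧
        -- convergence to the posterior and to the predictive measure
        ((∀ t, ∀ᵐ ω ∂P, ∫ z, BornFilter.likelihood b V s (Y (t + 1) ω) z
            ∂(BornFilter.predictive prior K (BornFilter.likelihood b V s)
              (fun r => Y r ω) t) ≠ 0) →
          ∀ t,
            (BornFilter.ConvergesInExpectation P
                (fun n ω => BornFilter.empirical (x n t ω))
                (fun ω => BornFilter.posterior prior K (BornFilter.likelihood b V s)
                  (fun r => Y r ω) t) ∧
              BornFilter.ConvergesAlmostSurely P
                (fun n ω => BornFilter.empirical (x n t ω))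
                (fun ω => BornFilter.posterior prior K (BornFilter.likelihood b V s)
                  (fun r => Y r ω) t)) ∧
            (BornFilter.ConvergesInExpectation P
                (fun n ω => BornFilter.empirical (xbar n (t + 1) ω))
                (fun ω => BornFilter.predictive prior K (BornFilter.likelihood b V s)
                  (fun r => Y r ω) t) ∧
              BornFilter.ConvergesAlmostSurely P
                (fun n ω => BornFilter.empirical (xbar n (t + 1) ω))
                (fun ω => BornFilter.predictive prior K (BornFilter.likelihood b V s)
                  (fun r => Y r ω) t)) ∧
            (BornFilter.ConvergesInExpectation P
                (fun n ω => (BornFilter.empirical (x n t ω)).bind (K t))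
                (fun ω => BornFilter.predictive prior K (BornFilter.likelihood b V s)
                  (fun r => Y r ω) t) ∧
              BornFilter.ConvergesAlmostSurely P
                (fun n ω => (BornFilter.empirical (x n t ω)).bind (K t))
                (fun ω => BornFilter.predictive prior K (BornFilter.likelihood b V s)
                  (fun r => Y r ω) t))))) := by
  have hρ := BornFilter.rho0_ne_zero hb hV
  rw [BornFilter.likelihood_eq_mul]
  -- Apart from the bound on `|ρ₀|`, only `ρ₀ ≠ 0` matters from here on.
  generalize hc : BornFilter.rho0 b V = c at hρ ⊢
  have hcont := BornFilter.continuous_bornProbability hs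
  have hgb := BornFilter.bornProbability_bounded hsb
  have hg := fun y => (hcont y).measurable
  refine ⟨hc ▸ BornFilter.abs_rho0_le_one hb hV, fun y => ⟨(hcont y).const_mul c, ?_⟩, ?_⟩
  · obtain ⟨C, hC⟩ := hgb y
    refine ⟨|c| * C, fun x => ?_⟩
    rw [abs_mul]
    exact mul_le_mul_of_nonneg_left (hC x) (abs_nonneg c)
  intro hs2 prior _ K _ _ Ω _ P _ Y hY
  have hg0 := BornFilter.bornProbability_nonneg hs2
  -- `predictive` is unfolded to expose the posterior inside it; the factor `c` then disappears from
  -- posteriors, weights and nonvanishing conditions.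
  simp only [BornFilter.predictive, BornFilter.posterior_const_mul hρ,
    BornFilter.weights_const_mul hρ, integral_const_mul, mul_ne_zero_iff, ne_eq, hρ,
    not_false_eq_true, true_and]
  refine ⟨fun X hM t => ?_, fun mutation x xbar ξ hF => ⟨fun t n hn f hf C hC => ?_, ?_⟩⟩
  · have hM' := hM.of_const_mul hρ
    exact ⟨hM'.hasCondLaw_posterior hg hg0 hgb (BornFilter.sum_bornProbability s) t,
      hM'.ae_integral_predictive_ne_zero hg hg0 hgb (BornFilter.sum_bornProbability s) t⟩
  · have hF' := (hF n hn).of_const_mul hρ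
    exact ⟨hF'.move_sq_le hY hn hf hC t, hF'.resampling_sq_le hY hg hg0 hn hf hC t⟩
  · exact fun hne t => BornFilter.bootstrapFilter_converges hY hg hg0 hgb
      (fun n hn => (hF n hn).of_const_mul hρ) hne t
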